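/- **Theorem 1.** For every $b\ge 1$ there are positive constants $c_1,c_2,c_3$, depending only on $b$, such that the following holds. Let $\mathcal G=([n],\mathcal E)$ be a connected (undirected, simple) comparison graph with degrees $d_i$, maximum degree $d_{\max}$ and minimum degree $d_{\min}$. Let $\mathcal L$ be the $n\times n$ matrix with $\mathcal L_{ij}=\frac1{d_i}\mathbb I[(i,j)\in\mathcal E]$, let $\gamma$ be the difference between the two largest absolute values of eigenvalues of $\mathcal L$ (counted with multiplicity), and assume $\gamma>0$. For a matrix $A$ put $\|A\|_{2,\infty}=\max_j\sqrt{\sum_i|A_{ij}|^2}$. Let $w_1\ge w_2\ge\dots\ge w_n>0$ be preference scores with $w_1/w_n\le b$, let $1\le K<n$, put $w_{\max}=w_1$ and assume that $\Delta_K:=(w_K-w_{K+1})/w_{\max}>0$. Suppose that every pair $(i,j)\in\mathcal E$ is compared $L$ times under the Bradley–Terry–Luce model: the outcomes $y_{ij}^{(\ell)}\in\{0,1\}$, $i<j$, $(i,j)\in\mathcal E$, $1\le\ell\le L$, are jointly independent, $y_{ij}^{(\ell)}=1$ (item $i$ beats item $j$) with probability $\frac{w_i}{w_i+w_j}$, and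 $y_{ji}^{(\ell)}=1-y_{ij}^{(\ell)}$. Let $y_{ij}=\frac1L\sum_{\ell=1}^L y_{ij}^{(\ell)}$. Rank Centrality forms the matrix $\hat P$ with $\hat P_{ij}=\frac1{d_{\max}}y_{ij}$ if $(i,j)\in\mathcal E$, $\hat P_{jj}=1-\frac1{d_{\max}}\sum_{k:(k,j)\in\mathcal E}y_{kj}$, and $\hat P_{ij}=0$ otherwise, computes its stationary distribution (a probability vector $p$ with $\hat P p=p$) by the power method started at the uniform distribution, and returns the indices of the $K$ largest components. If $$L\ \ge\ \left\lceil c_1\frac{\log n}{d_{\max}}\Big(\frac{d_{\max}}{\gamma d_{\min}}\Big)^2\right\rceil \quad\text{and}\quad L|\mathcal E|\ \ge\ \Big(c_2+c_3\frac{\sqrt n\,d_{\max}}{\gamma d_{\min}}\|\mathcal L^2\|_{2,\infty}\Big)^2\frac{|\mathcal E|\log n}{d_{\max}\Delta_K^2},$$ then with probability at least $1-2n^{-2}$ Rank Centrality identifies the top-$K$ set: the stationary distribution $p$ of $\hat P$ is unique, the power method converges to it, and $p_i>p_j$ for all $i\le K<j$, so that the returned set is $\{1,\dots,K\}$. -/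

import Mathlib

open MeasureTheory ProbabilityTheory Filter Topology

namespace RankCentrality

noncomputable section

/-- Outcomes of `L` repeated Bradley-Terry-Luce comparisons on every edge of the comparison
graph `G`, with preference scores `w`. `Y i j l ω = true` means that item `i` beats item `j` in the
`l`-th comparison between them. -/
structure IsBTLSample {n : ℕ} (G : SimpleGraph (Fin n)) (w : Fin n → ℝ) (L : ℕ)
    {Ω : Type*} [MeasurableSpace Ω] (μ : Measure Ω)
    (Y : Fin n → Fin n → Fin L → Ω → Bool) : Prop where
  measurable : ∀ i j l, G.Adj i j → Measurable (Y i j l)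
  /-- `i` beats `j` with probability `w i / (w i + w j)` -/
  law : ∀ i j l, G.Adj i j → μ.real {ω | Y i j l ω = true} = w i / (w i + w j)
  /-- the convention that the outcome for `(j, i)` is one minus the outcome for `(i, j)` -/
  swap : ∀ i j l ω, G.Adj i j → Y j i l ω = !(Y i j l ω)
  /-- joint independence over all edges `i < j` and all repetitions -/
  indep : iIndepFun
    (fun e : {e : Fin n × Fin n // e.1 < e.2 ∧ G.Adj e.1 e.2} × Fin L =>
      Y e.1.1.1 e.1.1.2 e.2) μ

/-- The fraction `y i j` of the `L` comparisons between `i` and `j` that `i` won. -/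
def winFraction {n L : ℕ} {Ω : Type*} (Y : Fin n → Fin n → Fin L → Ω → Bool) (ω : Ω) :
    Fin n → Fin n → ℝ :=
  fun i j => (1 / (L : ℝ)) * ∑ l : Fin L, if Y i j l ω = true then (1 : ℝ) else 0

/-- The (column stochastic) empirical transition matrix of Rank Centrality, computed from the
win fractions `y`. -/
def transitionMatrix {n : ℕ} (G : SimpleGraph (Fin n)) [DecidableRel G.Adj]
    (y : Fin n → Fin n → ℝ) : Matrix (Fin n) (Fin n) ℝ :=
  Matrix.of fun i j =>
    if i = j then 1 - (1 / (G.maxDegree : ℝ)) * ∑ k ∈ G.neighborFinset j, y k j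
    else if G.Adj i j then (1 / (G.maxDegree : ℝ)) * y i j
    else 0

/-- `p` is a stationary distribution of the column stochastic matrix `P`. -/
def IsStationary {n : ℕ} (P : Matrix (Fin n) (Fin n) ℝ) (p : Fin n → ℝ) : Prop :=
  (∀ i, 0 ≤ p i) ∧ ∑ i, p i = 1 ∧ P.mulVec p = p

/-- The `t`-th iterate of the power method for `P`, started at the uniform distribution. -/
def powerIterate {n : ℕ} (P : Matrix (Fin n) (Fin n) ℝ) (t : ℕ) : Fin n → ℝ :=
  (P ^ t).mulVec fun _ => 1 / (n : ℝ)

/-- Rank Centrality, run on the win fractions `y`, returns `S` as the set of the `K` top items: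
its transition matrix has exactly one stationary distribution `p`, the power method started at the
uniform distribution converges to `p`, and `S` is the set of the indices of the `K` largest
components of `p`, without a tie at the boundary (so that the output is unambiguous). -/
def Returns {n : ℕ} (G : SimpleGraph (Fin n)) [DecidableRel G.Adj]
    (y : Fin n → Fin n → ℝ) (K : ℕ) (S : Finset (Fin n)) : Prop :=
  ∃ p : Fin n → ℝ,
    IsStationary (transitionMatrix G y) p ∧
    (∀ q, IsStationary (transitionMatrix G y) q → q = p) ∧
    Tendsto (powerIterate (transitionMatrix G y)) atTop (𝓝 p) ∧
    S.card = K ∧ ∀ i ∈ S, ∀ j ∉ S, p j < p i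

/-- The set of the first `K` items. -/
def firstItems (n K : ℕ) : Finset (Fin n) :=
  Finset.univ.filter fun i => i.val < K

/-- The separation `(w_K - w_{K+1}) / w_max` (items are indexed from zero). -/
def separation {n : ℕ} (w : Fin n → ℝ) (K : ℕ) (hK : K < n) : ℝ :=
  (w ⟨K - 1, lt_of_le_of_lt (Nat.sub_le K 1) hK⟩ - w ⟨K, hK⟩) / ⨆ i, w i

/-- The matrix with entries `1 / d_i` for `(i, j)` an edge, and `0` otherwise. -/
def laplacian {n : ℕ} (G : SimpleGraph (Fin n)) [DecidableRel G.Adj] :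
    Matrix (Fin n) (Fin n) ℝ :=
  Matrix.of fun i j => if G.Adj i j then 1 / (G.degree i : ℝ) else 0

/-- The absolute values of all eigenvalues of a real square matrix (complex roots of its
characteristic polynomial, with multiplicity), in decreasing order. -/
def absEigenvalues {n : ℕ} (A : Matrix (Fin n) (Fin n) ℝ) : List ℝ :=
  ((A.map (algebraMap ℝ ℂ)).charpoly.roots.map fun z => ‖z‖).sort (· ≥ ·)

/-- The difference between the two largest absolute eigenvalues. -/
def spectralGap {n : ℕ} (A : Matrix (Fin n) (Fin n) ℝ) : ℝ :=
  (absEigenvalues A).getD 0 0 - (absEigenvalues A).getD 1 0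

/-- The largest Euclidean norm of a column. -/
def norm2Inf {n : ℕ} (A : Matrix (Fin n) (Fin n) ℝ) : ℝ :=
  ⨆ j, Real.sqrt (∑ i, |A i j| ^ 2)

end

end RankCentrality

/-! After scaling so that `w` has maximum one, every stationary vector is written as `p i = c * (w i
* (1 + h i))`. If every `|h i|` is below `Δ / 2`, then all entries of `p` are positive and the top
`K` are strictly separated. So the task is a uniform bound on `h`, which is a deterministic
perturbation argument followed by concentration of the comparison noise.

Deterministic part. Without noise the chain is reversible, with conductances `w i * w j / (w i + w
j)` that are at least `1 / (2 * b)`. Testing the balance equations against `h` bounds its Dirichlet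
energy by three noise terms. The Poincaré inequality (`spectralGap_le_one_and_poincare`) lets the
two quadratic terms be absorbed, and the linear one gives a degree-weighted `ℓ²` bound
(`relative_error_energy`). The balance equation also bounds `|h i|` by a neighbor average
(`relative_error_step`). Two such steps bring in the square of `laplacian G`, and
`laplacian_sq_mulVec_le` converts `ℓ²` control into uniform control through `norm2Inf`
(`relative_error_le`).

Random part. All three noise terms are quadratic forms of sums of fixed symmetric matrices weighted
by independent centered coins. `moment_bound` estimates the trace moments of such a sum by induction
on the power. Each step integrates out one coin and applies the trace inequality
`trace_mul_pow_sub_pow_le`. Markov's inequality with a moment of order `2 * ⌈log n⌉₊` gives failure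
probability at most `n⁻³` per term.

Uniqueness and convergence follow from the same bound: it makes every stationary distribution
positive, and the small noise makes the diagonal of the transition matrix positive, so that
`power_method_converges` applies. -/

namespace RankCentrality
open Matrix

/-! ### Symmetric matrices and sorted spectra. -/

/-- Orthogonal diagonalization of a real symmetric matrix. -/
lemma exists_orthogonal_diagonalization {ι : Type*} [Fintype ι] [DecidableEq ι]
    (A : Matrix ι ι ℝ) (hA : Aᵀ = A) :
    ∃ (U : Matrix ι ι ℝ) (ev : ι → ℝ), Uᵀ * U = 1 ∧ U * Uᵀ = 1 ∧
      A = U * diagonal ev * Uᵀ ∧ A.charpoly = ∏ i, (Polynomial.X - Polynomial.C (ev i)) := by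
  have hH : A.IsHermitian := by rwa [Matrix.IsHermitian, conjTranspose_eq_transpose_of_trivial]
  refine ⟨hH.eigenvectorUnitary, hH.eigenvalues, ?_, ?_, ?_, by simpa using hH.charpoly_eq⟩
  · have := Unitary.coe_star_mul_self hH.eigenvectorUnitary
    rwa [star_eq_conjTranspose, conjTranspose_eq_transpose_of_trivial] at this
  · have := Unitary.coe_mul_star_self hH.eigenvectorUnitary
    rwa [Unitary.coe_star, star_eq_conjTranspose, conjTranspose_eq_transpose_of_trivial] at this
  · have := hH.spectral_theorem
    rw [Unitary.conjStarAlgAut_apply, star_eq_conjTranspose,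
      conjTranspose_eq_transpose_of_trivial] at this
    exact this

lemma dotProduct_mulVec_diagonalization {ι : Type*} [Fintype ι] [DecidableEq ι]
    (U : Matrix ι ι ℝ) (ev z : ι → ℝ) :
    z ⬝ᵥ ((U * diagonal ev * Uᵀ) *ᵥ z) = ∑ i, ev i * (Uᵀ *ᵥ z) i ^ 2 := by
  rw [← mulVec_mulVec, ← mulVec_mulVec, dotProduct_mulVec, ← mulVec_transpose]
  simp only [dotProduct, mulVec_diagonal]
  exact Finset.sum_congr rfl fun i _ => by ring

lemma dotProduct_orthogonal {ι : Type*} [Fintype ι] [DecidableEq ι]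
    {U : Matrix ι ι ℝ} (hU : U * Uᵀ = 1) (y z : ι → ℝ) :
    (Uᵀ *ᵥ y) ⬝ᵥ (Uᵀ *ᵥ z) = y ⬝ᵥ z := by
  rw [dotProduct_mulVec, vecMul_transpose, mulVec_mulVec, hU, one_mulVec]

/-- The two leading entries of a sorted finite family, when a maximal member is known. -/
lemma sort_leading_gap {ι : Type*} [Fintype ι] [DecidableEq ι] (f : ι → ℝ) (i₀ : ι)
    (hmax : ∀ i, f i ≤ f i₀) (hf : ∀ i, 0 ≤ f i) :
    let l := (Multiset.map f Finset.univ.val).sort (· ≥ ·)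
    l.getD 0 0 - l.getD 1 0 ≤ f i₀ ∧ ∀ i, i ≠ i₀ → f i ≤ f i₀ - (l.getD 0 0 - l.getD 1 0) := by
  intro l
  set s : Multiset ℝ := Multiset.map f (Finset.univ.erase i₀).val with hs
  have hsplit : Multiset.map f Finset.univ.val = f i₀ ::ₘ s := by
    rw [hs, ← Multiset.map_cons, ← Finset.insert_val_of_notMem (Finset.notMem_erase i₀ _),
      Finset.insert_erase (Finset.mem_univ i₀)]
  have hl : l = f i₀ :: s.sort (· ≥ ·) := by
    simp only [l]
    rw [hsplit]
    refine Multiset.sort_cons _ _ _ ?_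
    intro b hb
    obtain ⟨i, -, rfl⟩ := Multiset.mem_map.1 hb
    exact hmax i
  have h0 : l.getD 0 0 = f i₀ := by rw [hl]; rfl
  have h1 : l.getD 1 0 = (s.sort (· ≥ ·)).getD 0 0 := by rw [hl]; rfl
  rw [h0, h1]
  have hsorted : (s.sort (· ≥ ·)).Pairwise (· ≥ ·) := Multiset.pairwise_sort _ _
  have hmem : ∀ x, x ∈ s.sort (· ≥ ·) ↔ x ∈ s := fun x => Multiset.mem_sort _
  have hnonneg : ∀ x ∈ s, 0 ≤ x := by
    intro x hx
    obtain ⟨i, -, rfl⟩ := Multiset.mem_map.1 hx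
    exact hf i
  have hin : ∀ i, i ≠ i₀ → f i ∈ s := fun i hi =>
    Multiset.mem_map.2 ⟨i, Finset.mem_erase.2 ⟨hi, Finset.mem_univ i⟩, rfl⟩
  -- With a single member there is no second entry: the default `0` is used, and the gap is `f i₀`
  -- itself.
  rcases hcase : s.sort (· ≥ ·) with _ | ⟨a, t⟩
  · refine ⟨by simp, fun i hi => ?_⟩
    have := (hmem _).2 (hin i hi)
    rw [hcase] at this
    simp at this
  · rw [hcase] at hsorted hmem
    refine ⟨?_, fun i hi => ?_⟩
    · simpa using hnonneg a ((hmem a).1 (by simp))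
    · have := (hmem _).2 (hin i hi)
      rcases List.mem_cons.1 this with h | h
      · simp [h]
      · simpa using (List.pairwise_cons.1 hsorted).1 _ h

/-! ### The spectral gap and the Poincaré inequality of the graph. -/

section Graph

variable {n : ℕ} (G : SimpleGraph (Fin n)) [DecidableRel G.Adj]

lemma sum_neighborFinset_swap (f : Fin n → Fin n → ℝ) :
    ∑ i, ∑ j ∈ G.neighborFinset i, f i j = ∑ i, ∑ j ∈ G.neighborFinset i, f j i := by
  refine Finset.sum_comm' ?_
  intro x y
  simp [SimpleGraph.adj_comm]

lemma sum_neighborFinset_left (g : Fin n → ℝ) :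
    ∑ i, ∑ _j ∈ G.neighborFinset i, g i = ∑ i, (G.degree i : ℝ) * g i := by
  simp [Finset.sum_const, nsmul_eq_mul]

lemma sum_neighborFinset_right (g : Fin n → ℝ) :
    ∑ i, ∑ j ∈ G.neighborFinset i, g j = ∑ i, (G.degree i : ℝ) * g i := by
  rw [sum_neighborFinset_swap G (fun _ j => g j), sum_neighborFinset_left]

/-- The adjacency matrix normalized symmetrically by the square roots of the degrees. -/
noncomputable def normalizedAdjacency : Matrix (Fin n) (Fin n) ℝ :=
  Matrix.of fun i j => if G.Adj i j then 1 / (√(G.degree i) * √(G.degree j)) else 0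

lemma normalizedAdjacency_transpose : (normalizedAdjacency G)ᵀ = normalizedAdjacency G := by
  ext i j
  simp [normalizedAdjacency, SimpleGraph.adj_comm, mul_comm]

variable {G}

/-- Conjugation by the square roots of the degrees makes the walk matrix symmetric. Its spectrum is
therefore real and can be studied by orthogonal diagonalization. -/
lemma laplacian_charpoly (hd : ∀ i, 0 < G.degree i) :
    (laplacian G).charpoly = (normalizedAdjacency G).charpoly := by
  have hs : ∀ i, √(G.degree i : ℝ) ≠ 0 := fun i =>
    (Real.sqrt_pos.2 (by exact_mod_cast hd i)).ne'
  have h1 : laplacian G = diagonal (fun i => (√(G.degree i : ℝ))⁻¹) *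
      (normalizedAdjacency G * diagonal (fun i => √(G.degree i : ℝ))) := by
    ext i j
    rw [diagonal_mul, mul_diagonal]
    simp only [laplacian, normalizedAdjacency, of_apply]
    split_ifs
    · have hi := hs i
      have hj := hs j
      have hdi : (G.degree i : ℝ) ≠ 0 := by exact_mod_cast (hd i).ne'
      field_simp
      rw [Real.sq_sqrt (Nat.cast_nonneg _)]
    · simp
  rw [h1, charpoly_mul_comm, mul_assoc, diagonal_mul_diagonal]
  simp [hs]

lemma normalizedAdjacency_form (hd : ∀ i, 0 < G.degree i) (g : Fin n → ℝ) :
    (fun i => √(G.degree i : ℝ) * g i) ⬝ᵥ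
      (normalizedAdjacency G *ᵥ fun i => √(G.degree i : ℝ) * g i) =
      ∑ i, ∑ j ∈ G.neighborFinset i, g i * g j := by
  have hs : ∀ i, √(G.degree i : ℝ) ≠ 0 := fun i =>
    (Real.sqrt_pos.2 (by exact_mod_cast hd i)).ne'
  simp only [dotProduct, mulVec, normalizedAdjacency, of_apply, Finset.mul_sum]
  refine Finset.sum_congr rfl fun i _ => ?_
  rw [SimpleGraph.neighborFinset_eq_filter, Finset.sum_filter]
  refine Finset.sum_congr rfl fun j _ => ?_
  have := hs i
  have := hs j
  split_ifs
  · field_simp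
  · simp

lemma sum_degree_sq (g : Fin n → ℝ) :
    ∑ i, (G.degree i : ℝ) * g i ^ 2 =
      1 / 2 * ∑ i, ∑ j ∈ G.neighborFinset i, (g i ^ 2 + g j ^ 2) := by
  simp only [Finset.sum_add_distrib]
  rw [sum_neighborFinset_left G (fun i => g i ^ 2), sum_neighborFinset_right G (fun i => g i ^ 2)]
  ring

lemma dirichlet_form_eq (g : Fin n → ℝ) :
    1 / 2 * ∑ i, ∑ j ∈ G.neighborFinset i, (g i - g j) ^ 2 =
      ∑ i, (G.degree i : ℝ) * g i ^ 2 - ∑ i, ∑ j ∈ G.neighborFinset i, g i * g j := by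
  rw [sum_degree_sq, Finset.mul_sum, Finset.mul_sum, ← Finset.sum_sub_distrib]
  refine Finset.sum_congr rfl fun i _ => ?_
  rw [Finset.mul_sum, Finset.mul_sum, ← Finset.sum_sub_distrib]
  exact Finset.sum_congr rfl fun j _ => by ring

/-- Edge by edge, `2 * |x * y| ≤ x ^ 2 + y ^ 2`. This is what confines the spectrum to `[-1, 1]`. -/
lemma abs_adjacency_form_le (g : Fin n → ℝ) :
    |∑ i, ∑ j ∈ G.neighborFinset i, g i * g j| ≤ ∑ i, (G.degree i : ℝ) * g i ^ 2 := by
  rw [sum_degree_sq, Finset.mul_sum]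
  refine (Finset.abs_sum_le_sum_abs _ _).trans (Finset.sum_le_sum fun i _ => ?_)
  rw [Finset.mul_sum]
  refine (Finset.abs_sum_le_sum_abs _ _).trans (Finset.sum_le_sum fun j _ => ?_)
  rw [abs_le]
  constructor <;> nlinarith [sq_nonneg (g i - g j), sq_nonneg (g i + g j)]

/-- The spectral gap is at most one, and it controls the Dirichlet form of the graph. -/
theorem spectralGap_le_one_and_poincare (hn : 0 < n) (hd : ∀ i, 0 < G.degree i)
    (hγ : 0 < spectralGap (laplacian G)) :
    spectralGap (laplacian G) ≤ 1 ∧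
    ∀ g : Fin n → ℝ, ∑ i, (G.degree i : ℝ) * g i = 0 →
      spectralGap (laplacian G) * ∑ i, (G.degree i : ℝ) * g i ^ 2 ≤
        1 / 2 * ∑ i, ∑ j ∈ G.neighborFinset i, (g i - g j) ^ 2 := by
  have hs : ∀ i, 0 < √(G.degree i : ℝ) := fun i => Real.sqrt_pos.2 (by exact_mod_cast hd i)
  obtain ⟨U, ev, hU1, hU2, hN, hchar⟩ :=
    exists_orthogonal_diagonalization _ (normalizedAdjacency_transpose G)
  have hform : ∀ g : Fin n → ℝ, ∑ i, ∑ j ∈ G.neighborFinset i, g i * g j =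
      ∑ i, ev i * (Uᵀ *ᵥ fun i => √(G.degree i : ℝ) * g i) i ^ 2 := by
    intro g
    rw [← normalizedAdjacency_form hd, hN, dotProduct_mulVec_diagonalization]
  have hnorm : ∀ g : Fin n → ℝ, ∑ i, (G.degree i : ℝ) * g i ^ 2 =
      ∑ i, (Uᵀ *ᵥ fun i => √(G.degree i : ℝ) * g i) i ^ 2 := by
    intro g
    have := dotProduct_orthogonal hU2 (fun i => √(G.degree i : ℝ) * g i)
      (fun i => √(G.degree i : ℝ) * g i)
    simp only [dotProduct] at this
    simp only [sq]
    rw [this]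
    refine Finset.sum_congr rfl fun i _ => ?_
    rw [mul_mul_mul_comm, Real.mul_self_sqrt (Nat.cast_nonneg _)]
  have hev : ∀ i, |ev i| ≤ 1 := by
    intro i
    -- Chosen so that its rescaling by the square roots of the degrees is the `i`-th eigenvector;
    -- the form inequality then reads `|ev i| ≤ 1`.
    set g : Fin n → ℝ := fun k => U k i / √(G.degree k : ℝ) with hg
    have hz : (fun k => √(G.degree k : ℝ) * g k) = U *ᵥ Pi.single i 1 := by
      ext k
      have := (hs k).ne'
      simp only [hg, mulVec_single_one, col_apply]
      field_simp
    have hk : ∀ k, (Uᵀ *ᵥ fun k => √(G.degree k : ℝ) * g k) k = if k = i then 1 else 0 := by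
      intro k
      rw [hz, mulVec_mulVec, hU1, one_mulVec, Pi.single_apply]
    have h1 := abs_adjacency_form_le (G := G) g
    rw [hform, hnorm] at h1
    simpa [hk] using h1
  have hroots : absEigenvalues (laplacian G) =
      (Multiset.map (fun i => |ev i|) Finset.univ.val).sort (· ≥ ·) := by
    rw [absEigenvalues, charpoly_map, laplacian_charpoly hd, hchar, Polynomial.map_prod]
    congr 1
    have : (∏ i, Polynomial.map (algebraMap ℝ ℂ) (Polynomial.X - Polynomial.C (ev i))).roots =
        Multiset.map (fun i => (ev i : ℂ)) Finset.univ.val := by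
      simp only [Polynomial.map_sub, Polynomial.map_X, Polynomial.map_C]
      exact Polynomial.roots_multiset_prod_X_sub_C
        (Multiset.map (fun i => (algebraMap ℝ ℂ) (ev i)) Finset.univ.val) |>.symm ▸ by
          rw [Multiset.map_map]; rfl
    rw [this, Multiset.map_map]
    simp
  have hgapdef : spectralGap (laplacian G) =
      (absEigenvalues (laplacian G)).getD 0 0 - (absEigenvalues (laplacian G)).getD 1 0 := rfl
  rw [hroots] at hgapdef
  -- The constant function in rescaled coordinates, an eigenvector for the eigenvalue one. Its
  -- coefficients `c` can live only where `ev` equals one.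
  set r : Fin n → ℝ := fun i => √(G.degree i : ℝ) * 1 with hr
  set c := Uᵀ *ᵥ r with hc
  have hNr : normalizedAdjacency G *ᵥ r = r := by
    ext i
    simp only [mulVec, dotProduct, normalizedAdjacency, of_apply, hr, mul_one]
    have : ∀ j, (if G.Adj i j then 1 / (√(G.degree i : ℝ) * √(G.degree j : ℝ)) else 0) *
        √(G.degree j : ℝ) = if G.Adj i j then 1 / √(G.degree i : ℝ) else 0 := by
      intro j
      have := (hs j).ne'
      have := (hs i).ne'
      split_ifs
      · field_simp
      · simp
    simp only [this]
    rw [← Finset.sum_filter, ← SimpleGraph.neighborFinset_eq_filter, Finset.sum_const, nsmul_eq_mul,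
      SimpleGraph.card_neighborFinset_eq_degree]
    have h2 := Real.mul_self_sqrt (Nat.cast_nonneg (α := ℝ) (G.degree i))
    have := (hs i).ne'
    rw [mul_one_div, div_eq_iff this, h2]
  have hcev : ∀ i, ev i * c i = c i := by
    intro i
    have h1 : Uᵀ *ᵥ (normalizedAdjacency G *ᵥ r) = c := by rw [hNr]
    have h2 : Uᵀ *ᵥ (normalizedAdjacency G *ᵥ r) = diagonal ev *ᵥ c := by
      rw [hN, mulVec_mulVec, hc, mulVec_mulVec, mul_assoc, ← mul_assoc Uᵀ, hU1, one_mul]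
    have h3 := congrFun (h2.symm.trans h1) i
    rwa [mulVec_diagonal] at h3
  obtain ⟨i₀, hi₀⟩ : ∃ i, c i ≠ 0 := by
    by_contra! h
    have h1 := dotProduct_orthogonal hU2 r r
    have h2 : Uᵀ *ᵥ r = 0 := by ext i; exact h i
    rw [h2, zero_dotProduct] at h1
    have h3 := (dotProduct_self_eq_zero (v := r)).1 h1.symm
    have h4 := congrFun h3 ⟨0, hn⟩
    simp only [hr, mul_one, Pi.zero_apply] at h4
    exact (hs ⟨0, hn⟩).ne' h4
  have hev0 : ev i₀ = 1 := by
    have := hcev i₀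
    exact mul_right_cancel₀ hi₀ (by rw [this, one_mul])
  obtain ⟨hle, hgap⟩ := sort_leading_gap (fun i => |ev i|) i₀
    (fun i => by simpa [hev0] using hev i) (fun i => abs_nonneg _)
  simp only [← hgapdef, hev0, abs_one] at hle hgap
  refine ⟨hle, fun g hg => ?_⟩
  -- The positive gap makes the eigenvalue one simple, so `r` spans its eigenspace. Weighted mean
  -- zero of `g` then kills the `i₀` coefficient, and only eigenvalues at most one minus the gap
  -- remain.
  have hci : ∀ i, i ≠ i₀ → c i = 0 := by
    intro i hi
    have h1 := (le_abs_self _).trans (hgap i hi)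
    have h2 := hcev i
    have h3 : (1 - ev i) * c i = 0 := by linarith
    rcases mul_eq_zero.1 h3 with h | h
    · linarith
    · exact h
  set a := Uᵀ *ᵥ fun i => √(G.degree i : ℝ) * g i with ha
  have ha0 : a i₀ = 0 := by
    have h1 := dotProduct_orthogonal hU2 (fun i => √(G.degree i : ℝ) * g i) r
    have h2 : (fun i => √(G.degree i : ℝ) * g i) ⬝ᵥ r = 0 := by
      rw [← hg]
      refine Finset.sum_congr rfl fun i _ => ?_
      simp only [hr, mul_one]
      rw [mul_right_comm, Real.mul_self_sqrt (Nat.cast_nonneg _)]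
    rw [h2] at h1
    have h3 : a ⬝ᵥ c = a i₀ * c i₀ := by
      refine Finset.sum_eq_single i₀ (fun i _ hi => by rw [hci i hi, mul_zero]) (by simp)
    rw [← ha, ← hc, h3] at h1
    exact (mul_eq_zero.1 h1).resolve_right hi₀
  have hfin : ∑ i, ∑ j ∈ G.neighborFinset i, g i * g j ≤
      (1 - spectralGap (laplacian G)) * ∑ i, (G.degree i : ℝ) * g i ^ 2 := by
    rw [hform, hnorm, ← ha, Finset.mul_sum]
    refine Finset.sum_le_sum fun i _ => ?_
    by_cases hi : i = i₀
    · rw [hi, ha0]; simp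
    · exact mul_le_mul_of_nonneg_right ((le_abs_self _).trans (hgap i hi)) (sq_nonneg _)
  rw [dirichlet_form_eq]
  linarith

end Graph

/-! ### Trace inequalities for powers of symmetric matrices. -/

section Trace

variable {ι : Type*} [Fintype ι] [DecidableEq ι]

lemma conj_diagonal_pow {U : Matrix ι ι ℝ} (hU : Uᵀ * U = 1) (hU' : U * Uᵀ = 1) (ev : ι → ℝ)
    (k : ℕ) : (U * diagonal ev * Uᵀ) ^ k = U * diagonal (fun i => ev i ^ k) * Uᵀ := by
  induction k with
  | zero => simp [hU']
  | succ k ih =>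
    have h : U * diagonal (fun i => ev i ^ k) * Uᵀ * (U * diagonal ev * Uᵀ) =
        U * (diagonal (fun i => ev i ^ k) * (Uᵀ * U) * diagonal ev) * Uᵀ := by
      simp only [mul_assoc]
    rw [pow_succ, ih, h, hU, mul_one, diagonal_mul_diagonal]
    simp only [pow_succ]

lemma trace_transpose_mul_diagonal_mul (B C : Matrix ι ι ℝ) (f : ι → ℝ) :
    trace (Bᵀ * diagonal f * C) = ∑ a, ∑ b, f a * (B a b * C a b) := by
  simp only [trace, diag_apply, mul_apply (M := Bᵀ * diagonal f), mul_diagonal, transpose_apply]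
  rw [Finset.sum_comm]
  exact Finset.sum_congr rfl fun a _ => Finset.sum_congr rfl fun b _ => by ring

lemma trace_transpose_mul_mul_self {V : Matrix ι ι ℝ} (hV : V * Vᵀ = 1) (M : Matrix ι ι ℝ) :
    trace (Vᵀ * (M * V)) = trace M := by
  rw [trace_mul_comm, mul_assoc, hV, mul_one]

/-- Factor the difference of powers as a geometric sum and pair each term with its reflection. With
`r + s = 2 * m`, `x ^ r * y ^ s + x ^ s * y ^ r ≤ x ^ (2 * m) + y ^ (2 * m)`, since `|x| ^ r - |y| ^
r` and `|x| ^ s - |y| ^ s` have the same sign. -/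
lemma sub_mul_pow_sub_pow_le (x y : ℝ) (m : ℕ) :
    (x - y) * (x ^ (2 * m + 1) - y ^ (2 * m + 1)) ≤
      (2 * m + 1) / 2 * ((x - y) ^ 2 * (x ^ (2 * m) + y ^ (2 * m))) := by
  have hgeom : x ^ (2 * m + 1) - y ^ (2 * m + 1) =
      (∑ r ∈ Finset.range (2 * m + 1), x ^ r * y ^ (2 * m - r)) * (x - y) := by
    rw [← geom_sum₂_mul]
    simp
  have hrefl : ∑ r ∈ Finset.range (2 * m + 1), x ^ r * y ^ (2 * m - r) =
      ∑ r ∈ Finset.range (2 * m + 1), x ^ (2 * m - r) * y ^ r := by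
    rw [← Finset.sum_range_reflect]
    refine Finset.sum_congr rfl fun r hr => ?_
    have hr' := Finset.mem_range.1 hr
    congr 2; omega
  have hterm : ∀ r ∈ Finset.range (2 * m + 1),
      x ^ r * y ^ (2 * m - r) + x ^ (2 * m - r) * y ^ r ≤ x ^ (2 * m) + y ^ (2 * m) := by
    intro r hr
    have hr' := Finset.mem_range.1 hr
    obtain ⟨s, hs⟩ : ∃ s, 2 * m = r + s := ⟨2 * m - r, by omega⟩
    have hs' : 2 * m - r = s := by omega
    rw [hs', ← (even_two_mul m).pow_abs x, ← (even_two_mul m).pow_abs y, hs, pow_add, pow_add]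
    have h1 : x ^ r * y ^ s ≤ |x| ^ r * |y| ^ s := by
      rw [← abs_pow, ← abs_pow, ← abs_mul]; exact le_abs_self _
    have h2 : x ^ s * y ^ r ≤ |x| ^ s * |y| ^ r := by
      rw [← abs_pow, ← abs_pow, ← abs_mul]; exact le_abs_self _
    have h3 : 0 ≤ (|x| ^ r - |y| ^ r) * (|x| ^ s - |y| ^ s) := by
      rcases le_total |x| |y| with h | h
      · exact mul_nonneg_of_nonpos_of_nonpos
          (sub_nonpos.2 (pow_le_pow_left₀ (abs_nonneg _) h _))
          (sub_nonpos.2 (pow_le_pow_left₀ (abs_nonneg _) h _))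
      · exact mul_nonneg (sub_nonneg.2 (pow_le_pow_left₀ (abs_nonneg _) h _))
          (sub_nonneg.2 (pow_le_pow_left₀ (abs_nonneg _) h _))
    nlinarith
  have hsum := Finset.sum_le_sum hterm
  rw [Finset.sum_add_distrib, ← hrefl, Finset.sum_const, Finset.card_range, nsmul_eq_mul] at hsum
  push_cast at hsum
  rw [hgeom]
  nlinarith [sq_nonneg (x - y)]

/-- A trapezoidal inequality for the trace of odd powers. -/
lemma trace_mul_pow_sub_pow_le {X Y A : Matrix ι ι ℝ} (hX : Xᵀ = X) (hY : Yᵀ = Y)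
    (hA : Aᵀ = A) (hXY : X - Y = A) (m : ℕ) :
    trace (A * X ^ (2 * m + 1)) - trace (A * Y ^ (2 * m + 1)) ≤
      (2 * m + 1) / 2 * (trace (A * X ^ (2 * m) * A) + trace (A * Y ^ (2 * m) * A)) := by
  obtain ⟨U, l, hU1, hU2, hXd, -⟩ := exists_orthogonal_diagonalization X hX
  obtain ⟨V, r, hV1, hV2, hYd, -⟩ := exists_orthogonal_diagonalization Y hY
  set B := Uᵀ * A * V with hB
  set C := Uᵀ * V with hC
  have hBt : Bᵀ = Vᵀ * A * U := by
    simp only [hB, transpose_mul, transpose_transpose, hA, mul_assoc]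
  have hCt : Cᵀ = Vᵀ * U := by
    simp only [hC, transpose_mul, transpose_transpose]
  -- Between an eigenvector of `X` and one of `Y`, the matrix `A = X - Y` acts as the difference of
  -- the eigenvalues. All four traces become double sums with common weights `C a b ^ 2`, and the
  -- claim reduces to `sub_mul_pow_sub_pow_le` term by term, although `X` and `Y` need not commute.
  have hBC : ∀ a b, B a b = (l a - r b) * C a b := by
    intro a b
    have h1 : B = diagonal l * C - C * diagonal r := by
      rw [hB, hC, ← hXY, mul_sub, sub_mul]
      congr 1
      · rw [hXd, ← mul_assoc, ← mul_assoc, hU1, one_mul, mul_assoc]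
      · have : Uᵀ * Y * V = Uᵀ * V * diagonal r * (Vᵀ * V) := by
          rw [hYd]; simp only [mul_assoc]
        rw [this, hV1, mul_one]
    rw [h1, Matrix.sub_apply, diagonal_mul, mul_diagonal]
    ring
  have hXp := fun k => conj_diagonal_pow hU1 hU2 l k
  have hYp := fun k => conj_diagonal_pow hV1 hV2 r k
  rw [← hXd] at hXp
  rw [← hYd] at hYp
  have t1 : ∀ k, trace (A * X ^ k) = ∑ a, ∑ b, l a ^ k * (B a b * C a b) := by
    intro k
    rw [← trace_transpose_mul_diagonal_mul, hBt, hXp]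
    have h1 : Vᵀ * A * U * diagonal (fun a => l a ^ k) * C =
        Vᵀ * (A * (U * diagonal (fun a => l a ^ k) * Uᵀ) * V) := by
      rw [hC]; simp only [mul_assoc]
    rw [h1, trace_transpose_mul_mul_self hV2]
  have t2 : ∀ k, trace (A * Y ^ k) = ∑ a, ∑ b, r b ^ k * (B a b * C a b) := by
    intro k
    have h0 := trace_transpose_mul_diagonal_mul Bᵀ Cᵀ (fun b => r b ^ k)
    rw [Finset.sum_comm] at h0
    simp only [transpose_apply] at h0
    rw [← h0, transpose_transpose, hYp, hB, hCt]
    have h1 : Uᵀ * A * V * diagonal (fun a => r a ^ k) * (Vᵀ * U) =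
        Uᵀ * (A * (V * diagonal (fun a => r a ^ k) * Vᵀ) * U) := by
      simp only [mul_assoc]
    rw [h1, trace_transpose_mul_mul_self hU2]
  have t3 : ∀ k, trace (A * X ^ k * A) = ∑ a, ∑ b, l a ^ k * (B a b * B a b) := by
    intro k
    rw [← trace_transpose_mul_diagonal_mul, hBt, hXp]
    have h1 : Vᵀ * A * U * diagonal (fun a => l a ^ k) * B =
        Vᵀ * (A * (U * diagonal (fun a => l a ^ k) * Uᵀ) * A * V) := by
      rw [hB]; simp only [mul_assoc]
    rw [h1, trace_transpose_mul_mul_self hV2]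
  have t4 : ∀ k, trace (A * Y ^ k * A) = ∑ a, ∑ b, r b ^ k * (B a b * B a b) := by
    intro k
    have h0 := trace_transpose_mul_diagonal_mul Bᵀ Bᵀ (fun b => r b ^ k)
    rw [Finset.sum_comm] at h0
    simp only [transpose_apply] at h0
    rw [← h0, transpose_transpose, hYp, hBt, hB]
    have h1 : Uᵀ * A * V * diagonal (fun a => r a ^ k) * (Vᵀ * A * U) =
        Uᵀ * (A * (V * diagonal (fun a => r a ^ k) * Vᵀ) * A * U) := by
      simp only [mul_assoc]
    rw [h1, trace_transpose_mul_mul_self hU2]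
  rw [t1, t2, t3, t4, ← Finset.sum_add_distrib, ← Finset.sum_sub_distrib, Finset.mul_sum]
  refine Finset.sum_le_sum fun a _ => ?_
  rw [← Finset.sum_add_distrib, ← Finset.sum_sub_distrib, Finset.mul_sum]
  refine Finset.sum_le_sum fun b _ => ?_
  have h := mul_le_mul_of_nonneg_right (sub_mul_pow_sub_pow_le (l a) (r b) m) (sq_nonneg (C a b))
  rw [hBC]
  calc _ = (l a - r b) * (l a ^ (2 * m + 1) - r b ^ (2 * m + 1)) * C a b ^ 2 := by ring
    _ ≤ _ := h
    _ = _ := by ring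

lemma trace_mul_pow_mul {X A : Matrix ι ι ℝ} (hX : Xᵀ = X) (hA : Aᵀ = A) (m : ℕ) :
    trace (A * X ^ (2 * m) * A) =
      ∑ j, (A *ᵥ (X ^ m).col j) ⬝ᵥ (A *ᵥ (X ^ m).col j) := by
  have h1 : A * X ^ (2 * m) * A = (A * X ^ m) * (A * X ^ m)ᵀ := by
    rw [transpose_mul, transpose_pow, hX, hA, two_mul, pow_add]
    simp only [mul_assoc]
  rw [h1, trace_mul_comm]
  rfl

lemma trace_mul_pow_mul_nonneg {X A : Matrix ι ι ℝ} (hX : Xᵀ = X) (hA : Aᵀ = A) (m : ℕ) :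
    0 ≤ trace (A * X ^ (2 * m) * A) := by
  rw [trace_mul_pow_mul hX hA]
  exact Finset.sum_nonneg fun j _ => Finset.sum_nonneg fun i _ => mul_self_nonneg _

/-- Each trace is a sum of squared norms of `A k` applied to the columns of `X ^ m`, so the variance
hypothesis applies column by column. -/
lemma sum_trace_mul_pow_mul_le {κ : Type*} [Fintype κ] {X : Matrix ι ι ℝ} (hX : Xᵀ = X)
    {A : κ → Matrix ι ι ℝ} (hA : ∀ k, (A k)ᵀ = A k) {v : ℝ}
    (hv : ∀ z, ∑ k, (A k *ᵥ z) ⬝ᵥ (A k *ᵥ z) ≤ v * (z ⬝ᵥ z)) (m : ℕ) :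
    ∑ k, trace (A k * X ^ (2 * m) * A k) ≤ v * trace (X ^ (2 * m)) := by
  have h1 : trace (X ^ (2 * m)) = ∑ j, (X ^ m).col j ⬝ᵥ (X ^ m).col j := by
    have := trace_mul_pow_mul hX (transpose_one (n := ι) (α := ℝ)) m
    simpa using this
  rw [h1, Finset.mul_sum, Finset.sum_congr rfl fun k _ => trace_mul_pow_mul hX (hA k) m,
    Finset.sum_comm]
  exact Finset.sum_le_sum fun j _ => hv _

/-- The quadratic form of a symmetric matrix is controlled by the trace of an even power. -/
lemma abs_form_le_of_trace_pow_le {X : Matrix ι ι ℝ} (hX : Xᵀ = X) {q : ℕ} (hq : q ≠ 0) {t : ℝ}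
    (ht : 0 ≤ t) (h : trace (X ^ (2 * q)) ≤ t ^ (2 * q)) (z : ι → ℝ) :
    |z ⬝ᵥ (X *ᵥ z)| ≤ t * (z ⬝ᵥ z) := by
  obtain ⟨U, l, hU1, hU2, hXd, -⟩ := exists_orthogonal_diagonalization X hX
  have htr : trace (X ^ (2 * q)) = ∑ i, l i ^ (2 * q) := by
    rw [hXd, conj_diagonal_pow hU1 hU2, trace_mul_comm, ← mul_assoc, hU1, one_mul,
      trace_diagonal]
  have hl : ∀ i, |l i| ≤ t := by
    intro i
    refine le_of_pow_le_pow_left₀ (n := 2 * q) (by omega) ht ?_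
    rw [(even_two_mul q).pow_abs]
    refine le_trans ?_ (htr ▸ h)
    exact Finset.single_le_sum (f := fun i => l i ^ (2 * q))
      (fun i _ => (even_two_mul q).pow_nonneg _) (Finset.mem_univ i)
  rw [hXd, dotProduct_mulVec_diagonalization, ← dotProduct_orthogonal hU2, dotProduct,
    Finset.mul_sum]
  refine (Finset.abs_sum_le_sum_abs _ _).trans (Finset.sum_le_sum fun i _ => ?_)
  rw [abs_mul, abs_of_nonneg (sq_nonneg ((Uᵀ *ᵥ z) i)), ← sq]
  exact mul_le_mul_of_nonneg_right (hl i) (sq_nonneg _)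

end Trace

/-! ### Moments and tails of matrix series in independent coin flips. -/

section Moments

variable {κ : Type*} [Fintype κ]

/-- The probability of the outcome `s` of independent coin flips with biases `ρ`. -/
noncomputable def coinWeight (ρ : κ → ℝ) (s : κ → Bool) : ℝ :=
  ∏ k, if s k = true then ρ k else 1 - ρ k

lemma coinWeight_nonneg {ρ : κ → ℝ} (h0 : ∀ k, 0 ≤ ρ k) (h1 : ∀ k, ρ k ≤ 1) (s : κ → Bool) :
    0 ≤ coinWeight ρ s := by
  refine Finset.prod_nonneg fun k _ => ?_
  split_ifs
  · exact h0 k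
  · linarith [h1 k]

variable [DecidableEq κ]

/-- Expectation with respect to independent coin flips with biases `ρ`. -/
noncomputable def coinExp (ρ : κ → ℝ) (F : (κ → Bool) → ℝ) : ℝ :=
  ∑ s, coinWeight ρ s * F s

lemma coinExp_mono {ρ : κ → ℝ} (h0 : ∀ k, 0 ≤ ρ k) (h1 : ∀ k, ρ k ≤ 1)
    {F F' : (κ → Bool) → ℝ} (h : ∀ s, F s ≤ F' s) : coinExp ρ F ≤ coinExp ρ F' :=
  Finset.sum_le_sum fun s _ => mul_le_mul_of_nonneg_left (h s) (coinWeight_nonneg h0 h1 s)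

lemma coinExp_sum {ν : Type*} (S : Finset ν) (ρ : κ → ℝ) (F : ν → (κ → Bool) → ℝ) :
    coinExp ρ (fun s => ∑ k ∈ S, F k s) = ∑ k ∈ S, coinExp ρ (F k) := by
  simp only [coinExp, Finset.mul_sum]
  exact Finset.sum_comm

lemma coinExp_const_mul (ρ : κ → ℝ) (c : ℝ) (F : (κ → Bool) → ℝ) :
    coinExp ρ (fun s => c * F s) = c * coinExp ρ F := by
  simp only [coinExp, Finset.mul_sum]
  exact Finset.sum_congr rfl fun s _ => by ring

/-- Resampling one coin does not change expectations. -/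
lemma coinExp_resample (ρ : κ → ℝ) (k : κ) (F : (κ → Bool) → ℝ) :
    coinExp ρ F = coinExp ρ (fun s => ρ k * F (Function.update s k true) +
      (1 - ρ k) * F (Function.update s k false)) := by
  -- Integrate out coin `k` first. The inner average depends only on the other coins, so averaging a
  -- second time changes nothing.
  have hsplit : ∀ H : (κ → Bool) → ℝ, coinExp ρ H =
      ∑ u : {j // j ≠ k} → Bool, (∏ j : {j // j ≠ k}, if u j = true then ρ j else 1 - ρ j) *
        (ρ k * H ((Equiv.funSplitAt k Bool).symm (true, u)) +
          (1 - ρ k) * H ((Equiv.funSplitAt k Bool).symm (false, u))) := by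
    intro H
    rw [coinExp, ← Equiv.sum_comp (Equiv.funSplitAt k Bool).symm, Fintype.sum_prod_type_right]
    refine Finset.sum_congr rfl fun u _ => ?_
    have hw : ∀ c : Bool, coinWeight ρ ((Equiv.funSplitAt k Bool).symm (c, u)) =
        (if c = true then ρ k else 1 - ρ k) *
          ∏ j : {j // j ≠ k}, if u j = true then ρ j else 1 - ρ j := by
      intro c
      rw [coinWeight, Fintype.prod_eq_mul_prod_subtype_ne _ k]
      congr 1
      · simp
      · refine Finset.prod_congr rfl fun j _ => ?_
        simp [j.2]
    rw [Fintype.sum_bool, hw, hw]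
    simp only [if_true, Bool.false_eq_true, if_false]
    ring
  have hup : ∀ (c c' : Bool) (u : {j // j ≠ k} → Bool),
      Function.update ((Equiv.funSplitAt k Bool).symm (c, u)) k c' =
        (Equiv.funSplitAt k Bool).symm (c', u) := by
    intro c c' u
    ext j
    by_cases hj : j = k
    · subst hj; simp
    · simp [hj]
  rw [hsplit F, hsplit]
  refine Finset.sum_congr rfl fun u _ => ?_
  simp only [hup]
  ring

/-- The centered value of a coin flip. -/
def centered {κ : Type*} (ρ : κ → ℝ) (k : κ) (s : κ → Bool) : ℝ :=
  (if s k = true then 1 else 0) - ρ k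

/-- Discrete integration by parts: the centered coin takes the value `1 - ρ k` with probability `ρ
k` and `-ρ k` otherwise. -/
lemma coinExp_centered_mul (ρ : κ → ℝ) (k : κ) (F : (κ → Bool) → ℝ) :
    coinExp ρ (fun s => centered ρ k s * F s) =
      coinExp ρ (fun s => ρ k * (1 - ρ k) *
        (F (Function.update s k true) - F (Function.update s k false))) := by
  rw [coinExp_resample ρ k]
  congr 1
  ext s
  simp only [centered, Function.update_self, if_true, Bool.false_eq_true, if_false]
  ring

variable {ι : Type*} [Fintype ι] [DecidableEq ι]

/-- The sum of matrices weighted by centered coin flips. -/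
def coinSeries {κ ι : Type*} [Fintype κ] (ρ : κ → ℝ) (A : κ → Matrix ι ι ℝ) (s : κ → Bool) :
    Matrix ι ι ℝ :=
  ∑ k, centered ρ k s • A k

lemma coinSeries_transpose {κ ι : Type*} [Fintype κ] (ρ : κ → ℝ) {A : κ → Matrix ι ι ℝ} (hA : ∀ k, (A k)ᵀ = A k)
    (s : κ → Bool) : (coinSeries ρ A s)ᵀ = coinSeries ρ A s := by
  simp [coinSeries, transpose_sum, hA]

lemma coinSeries_update_sub {ι : Type*} (ρ : κ → ℝ) (A : κ → Matrix ι ι ℝ) (s : κ → Bool) (k : κ) :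
    coinSeries ρ A (Function.update s k true) - coinSeries ρ A (Function.update s k false) =
      A k := by
  rw [coinSeries, coinSeries, ← Finset.sum_sub_distrib, Finset.sum_eq_single k]
  · simp only [centered, Function.update_self, if_true, Bool.false_eq_true, if_false, ← sub_smul]
    simp
  · intro j _ hj
    simp [centered, hj]
  · simp

/-- Split one factor off the power as a sum over coins and integrate each coin by parts. Flipping
coin `k` changes the series by exactly `A k`, so the trapezoidal trace inequality lowers the power
by two at the price of `A k` on both sides; summing over `k` turns these into the variance `v`. -/
lemma moment_step {ρ : κ → ℝ} (h0 : ∀ k, 0 ≤ ρ k) (h1 : ∀ k, ρ k ≤ 1)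
    {A : κ → Matrix ι ι ℝ} (hA : ∀ k, (A k)ᵀ = A k) {v : ℝ}
    (hv : ∀ z, ∑ k, (A k *ᵥ z) ⬝ᵥ (A k *ᵥ z) ≤ v * (z ⬝ᵥ z)) (m : ℕ) :
    coinExp ρ (fun s => trace (coinSeries ρ A s ^ (2 * (m + 1)))) ≤
      (2 * m + 1) / 2 * v * coinExp ρ (fun s => trace (coinSeries ρ A s ^ (2 * m))) := by
  have hT := coinSeries_transpose ρ hA
  have e1 : ∀ s, trace (coinSeries ρ A s ^ (2 * (m + 1))) =
      ∑ k, centered ρ k s * trace (A k * coinSeries ρ A s ^ (2 * m + 1)) := by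
    intro s
    rw [show 2 * (m + 1) = (2 * m + 1) + 1 by ring, pow_succ']
    nth_rewrite 1 [coinSeries]
    rw [Finset.sum_mul, trace_sum]
    simp [trace_smul]
  simp only [e1]
  rw [coinExp_sum]
  have e2 : ∀ k, coinExp ρ (fun s => centered ρ k s *
      trace (A k * coinSeries ρ A s ^ (2 * m + 1))) ≤
      (2 * m + 1) / 2 * coinExp ρ (fun s => trace (A k * coinSeries ρ A s ^ (2 * m) * A k)) := by
    intro k
    rw [coinExp_centered_mul, ← coinExp_const_mul, coinExp_resample ρ k
      (fun s => (2 * m + 1) / 2 * trace (A k * coinSeries ρ A s ^ (2 * m) * A k))]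
    refine coinExp_mono h0 h1 fun s => ?_
    have h2 := trace_mul_pow_sub_pow_le (hT (Function.update s k true))
      (hT (Function.update s k false)) (hA k) (coinSeries_update_sub ρ A s k) m
    have h3 := trace_mul_pow_mul_nonneg (hT (Function.update s k true)) (hA k) m
    have h4 := trace_mul_pow_mul_nonneg (hT (Function.update s k false)) (hA k) m
    set a := trace (A k * coinSeries ρ A (Function.update s k true) ^ (2 * m) * A k)
    set b := trace (A k * coinSeries ρ A (Function.update s k false) ^ (2 * m) * A k)
    have hk0 := h0 k
    have hk1 : 0 ≤ 1 - ρ k := by linarith [h1 k]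
    have hm : (0 : ℝ) ≤ (2 * m + 1) / 2 := by positivity
    refine (mul_le_mul_of_nonneg_left h2 (mul_nonneg hk0 hk1)).trans ?_
    -- Weakening the two coefficients to `ρ k` and `1 - ρ k` reproduces the resampled expectation.
    have h5 : ρ k * (1 - ρ k) * a ≤ ρ k * a := by
      nlinarith [mul_nonneg (mul_nonneg hk0 hk0) h3]
    have h6 : ρ k * (1 - ρ k) * b ≤ (1 - ρ k) * b := by
      nlinarith [mul_nonneg (mul_nonneg hk1 hk1) h4]
    nlinarith [mul_le_mul_of_nonneg_left (add_le_add h5 h6) hm]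
  refine (Finset.sum_le_sum fun k _ => e2 k).trans ?_
  have hm : (0 : ℝ) ≤ (2 * m + 1) / 2 := by positivity
  rw [← Finset.mul_sum, ← coinExp_sum, mul_assoc, ← coinExp_const_mul ρ v]
  exact mul_le_mul_of_nonneg_left
    (coinExp_mono h0 h1 fun s => sum_trace_mul_pow_mul_le (hT s) hA hv m) hm

lemma coinExp_one (ρ : κ → ℝ) : coinExp ρ (fun _ => 1) = 1 := by
  simp only [coinExp, coinWeight, mul_one]
  have := Finset.prod_univ_sum (fun _ : κ => (Finset.univ : Finset Bool))
    (fun k c => if c = true then ρ k else 1 - ρ k)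
  simp only [Fintype.piFinset_univ] at this
  rw [← this]
  simp

/-- Moment bound for matrix series in independent centered coin flips. -/
theorem moment_bound {ρ : κ → ℝ} (h0 : ∀ k, 0 ≤ ρ k) (h1 : ∀ k, ρ k ≤ 1)
    {A : κ → Matrix ι ι ℝ} (hA : ∀ k, (A k)ᵀ = A k) {v : ℝ} (hv0 : 0 ≤ v)
    (hv : ∀ z, ∑ k, (A k *ᵥ z) ⬝ᵥ (A k *ᵥ z) ≤ v * (z ⬝ᵥ z)) (q : ℕ) :
    coinExp ρ (fun s => trace (coinSeries ρ A s ^ (2 * q))) ≤ Fintype.card ι * (q * v) ^ q := by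
  suffices h : ∀ m, m ≤ q →
      coinExp ρ (fun s => trace (coinSeries ρ A s ^ (2 * m))) ≤
        Fintype.card ι * (q * v) ^ m from h q le_rfl
  intro m hm
  induction m with
  | zero =>
    have := coinExp_const_mul ρ (Fintype.card ι : ℝ) (fun _ => 1)
    rw [coinExp_one] at this
    simpa using this.le
  | succ m ih =>
    refine (moment_step h0 h1 hA hv m).trans ?_
    have hmq : ((m : ℝ) + 1) ≤ q := by exact_mod_cast hm
    -- The factor is `m + 1 / 2`, and `m + 1 ≤ q`.
    have h2 : (2 * (m : ℝ) + 1) / 2 * v ≤ q * v :=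
      mul_le_mul_of_nonneg_right (by linarith) hv0
    have h3 : 0 ≤ (2 * (m : ℝ) + 1) / 2 * v := by positivity
    calc _ ≤ (2 * (m : ℝ) + 1) / 2 * v * (Fintype.card ι * (q * v) ^ m) :=
          mul_le_mul_of_nonneg_left (ih (by omega)) h3
      _ ≤ q * v * (Fintype.card ι * (q * v) ^ m) :=
          mul_le_mul_of_nonneg_right h2 (by positivity)
      _ = _ := by ring

open Classical in
/-- Tail bound for the quadratic form of a matrix series in independent centered coin flips. -/
theorem coinWeight_tail_le {ρ : κ → ℝ} (h0 : ∀ k, 0 ≤ ρ k) (h1 : ∀ k, ρ k ≤ 1)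
    {A : κ → Matrix ι ι ℝ} (hA : ∀ k, (A k)ᵀ = A k) {v : ℝ} (hv0 : 0 ≤ v)
    (hv : ∀ z, ∑ k, (A k *ᵥ z) ⬝ᵥ (A k *ᵥ z) ≤ v * (z ⬝ᵥ z)) {q : ℕ} (hq : q ≠ 0)
    {t : ℝ} (ht : 0 < t) :
    ∑ s with ¬ (∀ z, |z ⬝ᵥ (coinSeries ρ A s *ᵥ z)| ≤ t * (z ⬝ᵥ z)), coinWeight ρ s ≤
      Fintype.card ι * (q * v / t ^ 2) ^ q := by
  have hT := coinSeries_transpose ρ hA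
  have hnn : ∀ s, 0 ≤ trace (coinSeries ρ A s ^ (2 * q)) := fun s => by
    have := trace_mul_pow_mul_nonneg (hT s) (transpose_one (n := ι) (α := ℝ)) q
    simpa using this
  have htq : 0 < t ^ (2 * q) := by positivity
  have h2 : ∑ s with ¬ (∀ z, |z ⬝ᵥ (coinSeries ρ A s *ᵥ z)| ≤ t * (z ⬝ᵥ z)), coinWeight ρ s ≤
      -- Markov's inequality: on a bad outcome the trace exceeds `t ^ (2 * q)`.
      coinExp ρ (fun s => (t ^ (2 * q))⁻¹ * trace (coinSeries ρ A s ^ (2 * q))) := by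
    rw [coinExp]
    refine (Finset.sum_le_sum (f := coinWeight ρ) (g := fun s => coinWeight ρ s *
      ((t ^ (2 * q))⁻¹ * trace (coinSeries ρ A s ^ (2 * q)))) fun s hs => ?_).trans
      (Finset.sum_le_sum_of_subset_of_nonneg (Finset.filter_subset _ _) fun s _ _ =>
        mul_nonneg (coinWeight_nonneg h0 h1 s) (mul_nonneg (by positivity) (hnn s)))
    have hbad := (Finset.mem_filter.1 hs).2
    have h3 : t ^ (2 * q) < trace (coinSeries ρ A s ^ (2 * q)) := by
      by_contra! h
      exact hbad (abs_form_le_of_trace_pow_le (hT s) hq ht.le h)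
    refine le_mul_of_one_le_right (coinWeight_nonneg h0 h1 s) ?_
    rw [inv_mul_eq_div, one_le_div htq]
    exact h3.le
  refine h2.trans ?_
  rw [coinExp_const_mul]
  refine (mul_le_mul_of_nonneg_left (moment_bound h0 h1 hA hv0 hv q) (by positivity)).trans ?_
  rw [div_pow, ← pow_mul, inv_mul_eq_div, mul_div_assoc]

open Classical in
/-- Tail bound for matrix series in independent Boolean random variables. -/
theorem measure_form_tail_le {Ω : Type*} [MeasurableSpace Ω] {μ : Measure Ω}
    [IsProbabilityMeasure μ] {Y : κ → Ω → Bool} (hY : ∀ k, Measurable (Y k))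
    (hind : iIndepFun Y μ) {ρ : κ → ℝ} (hρ : ∀ k, μ.real {ω | Y k ω = true} = ρ k)
    {A : κ → Matrix ι ι ℝ} (hA : ∀ k, (A k)ᵀ = A k) {v : ℝ} (hv0 : 0 ≤ v)
    (hv : ∀ z, ∑ k, (A k *ᵥ z) ⬝ᵥ (A k *ᵥ z) ≤ v * (z ⬝ᵥ z)) {q : ℕ} (hq : q ≠ 0)
    {t : ℝ} (ht : 0 < t) :
    μ.real {ω | ¬ ∀ z, |z ⬝ᵥ (coinSeries ρ A (fun k => Y k ω) *ᵥ z)| ≤ t * (z ⬝ᵥ z)} ≤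
      Fintype.card ι * (q * v / t ^ 2) ^ q := by
  have h0 : ∀ k, 0 ≤ ρ k := fun k => hρ k ▸ measureReal_nonneg
  have h1 : ∀ k, ρ k ≤ 1 := fun k => hρ k ▸ measureReal_le_one
  refine le_trans ?_ (coinWeight_tail_le h0 h1 hA hv0 hv hq ht)
  -- The joint law of the coins is the product weight, which reduces the claim to a finite sum.
  have hpt : ∀ s : κ → Bool, μ.real {ω | (fun k => Y k ω) = s} = coinWeight ρ s := by
    intro s
    have h2 : {ω | (fun k => Y k ω) = s} = ⋂ k ∈ Finset.univ, Y k ⁻¹' {s k} := by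
      ext ω
      simp [funext_iff]
    rw [measureReal_def, h2, hind.measure_inter_preimage_eq_mul Finset.univ
      (fun k _ => measurableSet_singleton _), ENNReal.toReal_prod, coinWeight]
    refine Finset.prod_congr rfl fun k _ => ?_
    rw [← measureReal_def]
    cases hs : s k
    · have h3 : Y k ⁻¹' {false} = {ω | Y k ω = true}ᶜ := by
        ext ω; simp
      have h4 : MeasurableSet {ω | Y k ω = true} := hY k (measurableSet_singleton true)
      rw [h3, probReal_compl_eq_one_sub h4, hρ]
      simp
    · simp only [if_true]
      exact hρ k
  set bad := (Finset.univ.filter fun s : κ → Bool =>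
    ¬ (∀ z, |z ⬝ᵥ (coinSeries ρ A s *ᵥ z)| ≤ t * (z ⬝ᵥ z))) with hbad
  have hsub : {ω | ¬ ∀ z, |z ⬝ᵥ (coinSeries ρ A (fun k => Y k ω) *ᵥ z)| ≤ t * (z ⬝ᵥ z)} ⊆
      ⋃ s ∈ bad, {ω | (fun k => Y k ω) = s} := by
    intro ω hω
    simp only [Set.mem_iUnion]
    exact ⟨fun k => Y k ω, Finset.mem_filter.2 ⟨Finset.mem_univ _, hω⟩, rfl⟩
  refine (measureReal_mono hsub (measure_ne_top _ _)).trans ((measureReal_biUnion_finset_le _ _).trans ?_)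
  exact (Finset.sum_congr rfl fun s _ => hpt s).le

end Moments

/-! ### Stationary distributions and convergence of the power method. -/

section Stochastic

variable {n : ℕ} {P : Matrix (Fin n) (Fin n) ℝ}

lemma sum_mulVec_of_column_sums (hcol : ∀ j, ∑ i, P i j = 1) (v : Fin n → ℝ) :
    ∑ i, (P *ᵥ v) i = ∑ i, v i := by
  simp only [mulVec, dotProduct]
  rw [Finset.sum_comm]
  simp only [← Finset.sum_mul, hcol, one_mul]

lemma mulVec_nonneg_of_nonneg (hnn : ∀ i j, 0 ≤ P i j) {v : Fin n → ℝ} (hv : ∀ i, 0 ≤ v i)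
    (i : Fin n) : 0 ≤ (P *ᵥ v) i := by
  simp only [mulVec, dotProduct]
  exact Finset.sum_nonneg fun j _ => mul_nonneg (hnn i j) (hv j)

lemma isStationary_normalize {v : Fin n → ℝ} (hv : ∀ i, 0 ≤ v i) (hs : 0 < ∑ i, v i)
    (hP : P *ᵥ v = v) : IsStationary P ((∑ i, v i)⁻¹ • v) := by
  refine ⟨fun i => mul_nonneg (inv_nonneg.2 hs.le) (hv i), ?_, by rw [mulVec_smul, hP]⟩
  simp only [Pi.smul_apply, smul_eq_mul, ← Finset.mul_sum]
  exact inv_mul_cancel₀ hs.ne'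

/-- The all-ones vector is a left eigenvector, so some `v ≠ 0` satisfies `P *ᵥ v = v`. Entrywise
`|v| ≤ P *ᵥ |v|`, and both sides have the same total, so equality holds and `|v|` can be normalized.
-/
lemma exists_isStationary (hn : 0 < n) (hnn : ∀ i j, 0 ≤ P i j) (hcol : ∀ j, ∑ i, P i j = 1) :
    ∃ p, IsStationary P p := by
  have hdet : (P - 1).det = 0 := by
    refine exists_vecMul_eq_zero_iff.1 ⟨fun _ => 1, ?_, ?_⟩
    · intro h
      exact one_ne_zero (congrFun h ⟨0, hn⟩)
    · rw [vecMul_sub, vecMul_one]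
      ext j
      simp [vecMul, dotProduct, hcol]
  obtain ⟨v, hv0, hv⟩ := exists_mulVec_eq_zero_iff.2 hdet
  rw [sub_mulVec, one_mulVec, sub_eq_zero] at hv
  have hle : ∀ i, |v i| ≤ (P *ᵥ fun j => |v j|) i := by
    intro i
    conv_lhs => rw [← hv]
    simp only [mulVec, dotProduct]
    refine (Finset.abs_sum_le_sum_abs _ _).trans (Finset.sum_le_sum fun j _ => ?_)
    rw [abs_mul, abs_of_nonneg (hnn i j)]
  have heq : P *ᵥ (fun j => |v j|) = fun j => |v j| := by
    ext i
    exact ((Finset.sum_eq_sum_iff_of_le fun i _ => hle i).1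
      (sum_mulVec_of_column_sums hcol fun j => |v j|).symm i (Finset.mem_univ i)).symm
  refine ⟨_, isStationary_normalize (fun i => abs_nonneg (v i)) ?_ heq⟩
  obtain ⟨i, hi⟩ := Function.ne_iff.1 hv0
  exact Finset.sum_pos' (fun i _ => abs_nonneg _) ⟨i, Finset.mem_univ i, abs_pos.2 hi⟩

/-- If all stationary distributions are positive, there is at most one of them. -/
lemma isStationary_unique (hn : 0 < n) (hpos : ∀ p, IsStationary P p → ∀ i, 0 < p i)
    {p q : Fin n → ℝ} (hp : IsStationary P p) (hq : IsStationary P q) : q = p := by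
  have : Nonempty (Fin n) := ⟨⟨0, hn⟩⟩
  obtain ⟨i₀, hi₀⟩ := Finite.exists_min fun i => p i / q i
  -- The largest multiple of `q` below `p`. The difference is a nonnegative fixed vector vanishing
  -- at `i₀`; were it nonzero, it would normalize to a stationary distribution with a zero entry.
  set t := p i₀ / q i₀ with ht
  have hqpos := hpos q hq
  have hnn : ∀ i, 0 ≤ p i - t * q i := by
    intro i
    have := (le_div_iff₀ (hqpos i)).1 (hi₀ i)
    linarith
  have hz : p i₀ - t * q i₀ = 0 := by
    rw [ht, div_mul_cancel₀ _ (hqpos i₀).ne', sub_self]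
  have hsum : ∑ i, (p i - t * q i) = 1 - t := by
    rw [Finset.sum_sub_distrib, ← Finset.mul_sum, hp.2.1, hq.2.1, mul_one]
  have hfix : P *ᵥ (fun i => p i - t * q i) = fun i => p i - t * q i := by
    have : (fun i => p i - t * q i) = p - t • q := by ext i; simp
    rw [this, mulVec_sub, mulVec_smul, hp.2.2, hq.2.2]
  rcases (Finset.sum_nonneg fun i _ => hnn i).lt_or_eq with h | h
  · have := hpos _ (isStationary_normalize hnn h hfix) i₀
    simp [hz] at this
  · have h0 := (Finset.sum_eq_zero_iff_of_nonneg fun i _ => hnn i).1 h.symm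
    have ht1 : t = 1 := by linarith
    ext i
    have := h0 i (Finset.mem_univ i)
    rw [ht1] at this
    linarith

/-- Decay of the chi-square functional along a chain with a lazy step. -/
lemma chi_square_decrease (hnn : ∀ i j, 0 ≤ P i j) {p : Fin n → ℝ} (hppos : ∀ i, 0 < p i)
    (hcol : ∀ j, ∑ i, P i j = 1) (hfix : P *ᵥ p = p) (v : Fin n → ℝ) :
    ∑ i, P i i * p i * (v i / p i - (P *ᵥ v) i / p i) ^ 2 ≤
      ∑ i, v i ^ 2 / p i - ∑ i, (P *ᵥ v) i ^ 2 / p i := by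
  have hrow : ∀ i, ∑ j, P i j * p j = p i := fun i => congrFun hfix i
  have hPv : ∀ i, ∑ j, P i j * v j = (P *ᵥ v) i := fun i => rfl
  have hvar : ∀ i, P i i * p i * (v i / p i - (P *ᵥ v) i / p i) ^ 2 ≤
      ∑ j, P i j * (v j ^ 2 / p j) - (P *ᵥ v) i ^ 2 / p i := by
    intro i
    -- This is the mean of `v / p` under the weights `P i j * p j / p i`. The variance about it is a
    -- sum of nonnegative terms, of which only the one at `j = i` is kept.
    set m := (P *ᵥ v) i / p i with hm
    have h1 : ∑ j, P i j * p j * (v j / p j - m) ^ 2 =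
        ∑ j, P i j * (v j ^ 2 / p j) - (P *ᵥ v) i ^ 2 / p i := by
      have h2 : ∀ j, P i j * p j * (v j / p j - m) ^ 2 =
          P i j * (v j ^ 2 / p j) - 2 * m * (P i j * v j) + m ^ 2 * (P i j * p j) := by
        intro j
        have := (hppos j).ne'
        field_simp
        ring
      simp only [h2]
      rw [Finset.sum_add_distrib, Finset.sum_sub_distrib, ← Finset.mul_sum, ← Finset.mul_sum,
        hrow, hPv, hm]
      have := (hppos i).ne'
      field_simp
      ring
    rw [← h1]
    exact Finset.single_le_sum (f := fun j => P i j * p j * (v j / p j - m) ^ 2)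
      (fun j _ => mul_nonneg (mul_nonneg (hnn i j) (hppos j).le) (sq_nonneg _)) (Finset.mem_univ i)
  refine (Finset.sum_le_sum fun i _ => hvar i).trans ?_
  rw [Finset.sum_sub_distrib, Finset.sum_comm]
  simp only [← Finset.sum_mul, hcol, one_mul, le_refl]

/-- Convergence of the power method for a column stochastic matrix with positive diagonal, all of
whose stationary distributions are positive. -/
theorem power_method_converges (hn : 0 < n) (hnn : ∀ i j, 0 ≤ P i j)
    (hcol : ∀ j, ∑ i, P i j = 1) (hdiag : ∀ i, 0 < P i i)
    (hpos : ∀ p, IsStationary P p → ∀ i, 0 < p i) :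
    ∃ p, IsStationary P p ∧ (∀ q, IsStationary P q → q = p) ∧
      Tendsto (powerIterate P) atTop (𝓝 p) := by
  obtain ⟨p, hp⟩ := exists_isStationary hn hnn hcol
  have huniq : ∀ q, IsStationary P q → q = p := fun q hq => isStationary_unique hn hpos hp hq
  refine ⟨p, hp, huniq, ?_⟩
  have hppos := hpos p hp
  set v := powerIterate P with hv
  have hstep : ∀ t, v (t + 1) = P *ᵥ v t := by
    intro t
    simp only [hv, powerIterate, pow_succ', mulVec_mulVec]
  have hv0 : v 0 = fun _ => 1 / (n : ℝ) := by simp [hv, powerIterate]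
  have hvnn : ∀ t i, 0 ≤ v t i := by
    intro t
    induction t with
    | zero => intro i; rw [hv0]; positivity
    | succ t ih => rw [hstep]; exact mulVec_nonneg_of_nonneg hnn ih
  have hvsum : ∀ t, ∑ i, v t i = 1 := by
    intro t
    induction t with
    | zero => rw [hv0]; simp [hn.ne']
    | succ t ih => rw [hstep, sum_mulVec_of_column_sums hcol, ih]
  set D : ℕ → ℝ := fun t => ∑ i, P i i * p i * (v t i / p i - v (t + 1) i / p i) ^ 2 with hD
  set Φ : ℕ → ℝ := fun t => ∑ i, v t i ^ 2 / p i with hΦ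
  have hDnn : ∀ t, 0 ≤ D t := fun t => Finset.sum_nonneg fun i _ =>
    mul_nonneg (mul_nonneg (hdiag i).le (hppos i).le) (sq_nonneg _)
  have hdec : ∀ t, D t ≤ Φ t - Φ (t + 1) := by
    intro t
    have := chi_square_decrease hnn hppos hcol hp.2.2 (v t)
    simpa only [hD, hΦ, hstep] using this
  -- The drops of the chi-square functional telescope, so `D` tends to zero. By compactness of the
  -- simplex it suffices to identify cluster points: there `E` vanishes, and positivity of `P i i`
  -- and `p i` forces a fixed point.
  have hsummable : Summable D := by
    refine summable_of_sum_range_le (c := Φ 0) hDnn fun T => ?_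
    calc ∑ t ∈ Finset.range T, D t ≤ ∑ t ∈ Finset.range T, (Φ t - Φ (t + 1)) :=
          Finset.sum_le_sum fun t _ => hdec t
      _ = Φ 0 - Φ T := Finset.sum_range_sub' _ _
      _ ≤ Φ 0 := sub_le_self _ (Finset.sum_nonneg fun i _ =>
          div_nonneg (sq_nonneg _) (hppos i).le)
  have hD0 : Tendsto D atTop (𝓝 0) := hsummable.tendsto_atTop_zero
  have hcompact : IsCompact (stdSimplex ℝ (Fin n)) := isCompact_stdSimplex ℝ (Fin n)
  refine hcompact.tendsto_nhds_of_unique_mapClusterPt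
    (Eventually.of_forall fun t => ⟨hvnn t, hvsum t⟩) ?_
  intro q hq hcl
  refine huniq q ⟨hq.1, hq.2, ?_⟩
  set E : (Fin n → ℝ) → ℝ := fun x => ∑ i, P i i * p i * (x i / p i - (P *ᵥ x) i / p i) ^ 2 with hE
  have hEcont : Continuous E := by
    simp only [hE, mulVec, dotProduct]
    fun_prop
  have hEv : ∀ t, E (v t) = D t := fun t => by simp only [hE, hD, hstep]
  have hEcl : MapClusterPt (E q) atTop D := by
    have := hcl.continuousAt_comp hEcont.continuousAt
    have h2 : E ∘ v = D := funext hEv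
    rwa [h2] at this
  obtain ⟨ψ, hψ, hlim⟩ := hEcl.tendsto_subseq
  have hE0 : E q = 0 := tendsto_nhds_unique hlim (hD0.comp hψ.tendsto_atTop)
  have hterm := (Finset.sum_eq_zero_iff_of_nonneg fun i _ =>
    mul_nonneg (mul_nonneg (hdiag i).le (hppos i).le) (sq_nonneg _)).1 hE0
  ext i
  have h1 := hterm i (Finset.mem_univ i)
  have h2 : q i / p i - (P *ᵥ q) i / p i = 0 := by
    rcases mul_eq_zero.1 h1 with h | h
    · exact absurd h (mul_pos (hdiag i) (hppos i)).ne'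
    · exact pow_eq_zero_iff (two_ne_zero) |>.1 h
  rw [← sub_div, div_eq_zero_iff] at h2
  rcases h2 with h | h
  · linarith
  · exact absurd h (hppos i).ne'

end Stochastic

/-! ### The empirical transition matrix. -/

section Transition

variable {n : ℕ} {G : SimpleGraph (Fin n)} [DecidableRel G.Adj] {y : Fin n → Fin n → ℝ}

lemma transitionMatrix_mulVec (v : Fin n → ℝ) (i : Fin n) :
    (transitionMatrix G y *ᵥ v) i = v i + 1 / (G.maxDegree : ℝ) *
      (∑ j ∈ G.neighborFinset i, y i j * v j - (∑ j ∈ G.neighborFinset i, y j i) * v i) := by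
  have h1 : ∀ j, transitionMatrix G y i j * v j =
      (if i = j then (1 - 1 / (G.maxDegree : ℝ) * ∑ k ∈ G.neighborFinset j, y k j) * v j else 0) +
      1 / (G.maxDegree : ℝ) * (if G.Adj i j then y i j * v j else 0) := by
    intro j
    simp only [transitionMatrix, of_apply]
    by_cases hij : i = j
    · subst hij; simp
    · by_cases ha : G.Adj i j
      · simp [hij, ha, mul_assoc]
      · simp [hij, ha]
  simp only [mulVec, dotProduct, h1]
  rw [Finset.sum_add_distrib, Finset.sum_ite_eq, if_pos (Finset.mem_univ i), ← Finset.mul_sum,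
    ← Finset.sum_filter, ← SimpleGraph.neighborFinset_eq_filter]
  ring

lemma transitionMatrix_column_sum (j : Fin n) : ∑ i, transitionMatrix G y i j = 1 := by
  have h1 : ∀ i, transitionMatrix G y i j =
      (if i = j then (1 - 1 / (G.maxDegree : ℝ) * ∑ k ∈ G.neighborFinset j, y k j) else 0) +
      1 / (G.maxDegree : ℝ) * (if G.Adj j i then y i j else 0) := by
    intro i
    simp only [transitionMatrix, of_apply]
    by_cases hij : i = j
    · subst hij; simp
    · by_cases ha : G.Adj i j
      · simp [hij, ha, ha.symm]
      · have ha' : ¬ G.Adj j i := fun h => ha h.symm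
        simp [hij, ha, ha']
  simp only [h1]
  rw [Finset.sum_add_distrib, Finset.sum_ite_eq', if_pos (Finset.mem_univ j), ← Finset.mul_sum,
    ← Finset.sum_filter, ← SimpleGraph.neighborFinset_eq_filter]
  ring

/-- The diagonal of the transition matrix is positive where some comparison was won. -/
lemma transitionMatrix_diag_pos (hswap : ∀ i j, G.Adj i j → y j i = 1 - y i j) {i : Fin n}
    (hd : 0 < G.degree i) (hwin : 0 < ∑ j ∈ G.neighborFinset i, y i j) :
    0 < transitionMatrix G y i i := by
  simp only [transitionMatrix, of_apply, if_true]
  have h1 : ∑ k ∈ G.neighborFinset i, y k i =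
      G.degree i - ∑ k ∈ G.neighborFinset i, y i k := by
    rw [Finset.sum_congr rfl fun k hk => hswap i k ((G.mem_neighborFinset i k).1 hk),
      Finset.sum_sub_distrib]
    simp
  have h2 : (G.degree i : ℝ) ≤ G.maxDegree := by exact_mod_cast G.degree_le_maxDegree i
  have h3 : (0 : ℝ) < G.degree i := by exact_mod_cast hd
  rw [sub_pos, one_div, inv_mul_eq_div, div_lt_one (by linarith), h1]
  linarith

lemma transitionMatrix_nonneg (hy : ∀ i j, 0 ≤ y i j)
    (hdiag : ∀ i, 0 < transitionMatrix G y i i) (i j : Fin n) :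
    0 ≤ transitionMatrix G y i j := by
  by_cases hij : i = j
  · subst hij; exact (hdiag i).le
  · simp only [transitionMatrix, of_apply, if_neg hij]
    split_ifs
    · exact mul_nonneg (by positivity) (hy i j)
    · exact le_rfl

lemma flow_balance (hdmax : 0 < G.maxDegree) {p : Fin n → ℝ}
    (hp : transitionMatrix G y *ᵥ p = p) (i : Fin n) :
    ∑ j ∈ G.neighborFinset i, (y i j * p j - y j i * p i) = 0 := by
  have h1 := congrFun hp i
  rw [transitionMatrix_mulVec] at h1
  have h2 : (0 : ℝ) < 1 / (G.maxDegree : ℝ) := by positivity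
  have h3 := (mul_eq_zero.1 (add_eq_left.1 h1)).resolve_left h2.ne'
  rw [Finset.sum_sub_distrib, ← Finset.sum_mul, h3]

end Transition

/-! ### Two steps of the random walk on the graph. -/

section TwoStep

variable {n : ℕ} {G : SimpleGraph (Fin n)} [DecidableRel G.Adj]

lemma laplacian_mulVec (a : Fin n → ℝ) (i : Fin n) :
    (laplacian G *ᵥ a) i = 1 / (G.degree i : ℝ) * ∑ j ∈ G.neighborFinset i, a j := by
  simp only [mulVec, dotProduct, laplacian, of_apply]
  rw [Finset.mul_sum, SimpleGraph.neighborFinset_eq_filter, Finset.sum_filter]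
  exact Finset.sum_congr rfl fun j _ => by split_ifs <;> simp

lemma laplacian_nonneg (i j : Fin n) : 0 ≤ laplacian G i j := by
  simp only [laplacian, of_apply]
  split_ifs <;> positivity

lemma laplacian_mulVec_const (hd : ∀ i, 0 < G.degree i) (c : ℝ) :
    laplacian G *ᵥ (fun _ => c) = fun _ => c := by
  ext i
  have : (G.degree i : ℝ) ≠ 0 := by exact_mod_cast (hd i).ne'
  rw [laplacian_mulVec]
  simp only [Finset.sum_const, SimpleGraph.card_neighborFinset_eq_degree, nsmul_eq_mul]
  field_simp

lemma laplacian_mulVec_mono {a a' : Fin n → ℝ} (h : ∀ i, a i ≤ a' i) (i : Fin n) :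
    (laplacian G *ᵥ a) i ≤ (laplacian G *ᵥ a') i := by
  simp only [mulVec, dotProduct]
  exact Finset.sum_le_sum fun j _ => mul_le_mul_of_nonneg_left (h j) (laplacian_nonneg i j)

/-- Detailed balance for two steps of the random walk. -/
lemma degree_mul_laplacian_sq (hd : ∀ i, 0 < G.degree i) (i j : Fin n) :
    (G.degree i : ℝ) * (laplacian G ^ 2) i j = G.degree j * (laplacian G ^ 2) j i := by
  simp only [sq, mul_apply, Finset.mul_sum]
  refine Finset.sum_congr rfl fun k _ => ?_
  have hi : (G.degree i : ℝ) ≠ 0 := by exact_mod_cast (hd i).ne'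
  have hj : (G.degree j : ℝ) ≠ 0 := by exact_mod_cast (hd j).ne'
  simp only [laplacian, of_apply, G.adj_comm k]
  by_cases h1 : G.Adj i k <;> by_cases h2 : G.Adj j k <;> simp [h1, h2]
  field_simp

lemma norm2Inf_nonneg (A : Matrix (Fin n) (Fin n) ℝ) : 0 ≤ norm2Inf A :=
  Real.iSup_nonneg fun _ => Real.sqrt_nonneg _

lemma column_sq_sum_le (A : Matrix (Fin n) (Fin n) ℝ) (j : Fin n) :
    ∑ i, A i j ^ 2 ≤ norm2Inf A ^ 2 := by
  have h1 : √(∑ i, |A i j| ^ 2) ≤ norm2Inf A :=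
    le_ciSup (f := fun j => √(∑ i, |A i j| ^ 2)) (Set.finite_range _).bddAbove j
  have h2 := (Real.sqrt_le_left (norm2Inf_nonneg A)).1 h1
  simpa only [sq_abs] using h2

/-- Rows of the squared walk matrix sum to one, so by Cauchy–Schwarz each has squared norm at least
`1 / n`; hence the total of squared entries is at least one, and it is at most `n` times the largest
squared column norm. This lets lower-order errors be absorbed into the `norm2Inf` term. -/
lemma one_le_card_mul_norm2Inf_sq (hn : 0 < n) (hd : ∀ i, 0 < G.degree i) :
    1 ≤ (n : ℝ) * norm2Inf (laplacian G ^ 2) ^ 2 := by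
  set B := laplacian G ^ 2 with hB
  have hnR : (0 : ℝ) < n := by exact_mod_cast hn
  have hrow : ∀ i, ∑ j, B i j = 1 := by
    intro i
    have h1 : B *ᵥ (fun _ => 1) = fun _ => (1 : ℝ) := by
      rw [hB, sq, ← mulVec_mulVec, laplacian_mulVec_const hd, laplacian_mulVec_const hd]
    have h2 := congrFun h1 i
    simpa [mulVec, dotProduct] using h2
  have h1 : ∀ i, 1 ≤ (n : ℝ) * ∑ j, B i j ^ 2 := by
    intro i
    have := sq_sum_le_card_mul_sum_sq (s := (Finset.univ : Finset (Fin n))) (f := fun j => B i j)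
    simpa [hrow] using this
  have h2 : (n : ℝ) ≤ n * ∑ i, ∑ j, B i j ^ 2 := by
    rw [Finset.mul_sum]
    have := Finset.sum_le_sum fun i (_ : i ∈ Finset.univ) => h1 i
    simpa using this
  rw [Finset.sum_comm] at h2
  have h3 : ∑ j, ∑ i, B i j ^ 2 ≤ n * norm2Inf B ^ 2 := by
    have := Finset.sum_le_sum fun j (_ : j ∈ Finset.univ) => column_sq_sum_le B j
    simpa using this
  have h4 := h2.trans (mul_le_mul_of_nonneg_left h3 hnR.le)
  exact le_of_mul_le_mul_left (by linarith) hnR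

/-- Two steps of the random walk turn a degree-weighted `ℓ²` bound into a uniform bound. -/
lemma laplacian_sq_mulVec_le (hd : ∀ i, 0 < G.degree i) (a : Fin n → ℝ) (i : Fin n) :
    ((laplacian G ^ 2) *ᵥ a) i ≤ norm2Inf (laplacian G ^ 2) * (√G.maxDegree / G.minDegree) *
      √(∑ j, (G.degree j : ℝ) * a j ^ 2) := by
  set B := laplacian G ^ 2 with hB
  have hdR : ∀ j, (0 : ℝ) < G.degree j := fun j => by exact_mod_cast hd j
  have hmin : (0 : ℝ) < G.minDegree := by
    have : Nonempty (Fin n) := ⟨i⟩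
    obtain ⟨k, hk⟩ := G.exists_minimal_degree_vertex
    rw [hk]; exact hdR k
  have hmini : (G.minDegree : ℝ) ≤ G.degree i := by exact_mod_cast G.minDegree_le_degree i
  have hcs := Real.sum_mul_le_sqrt_mul_sqrt Finset.univ (fun j => B i j / √(G.degree j : ℝ))
    (fun j => √(G.degree j : ℝ) * a j)
  have h1 : ∑ j, B i j / √(G.degree j : ℝ) * (√(G.degree j : ℝ) * a j) = (B *ᵥ a) i := by
    refine Finset.sum_congr rfl fun j _ => ?_
    have := (Real.sqrt_pos.2 (hdR j)).ne'
    field_simp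
  have h2 : ∑ j, (√(G.degree j : ℝ) * a j) ^ 2 = ∑ j, (G.degree j : ℝ) * a j ^ 2 :=
    Finset.sum_congr rfl fun j _ => by rw [mul_pow, Real.sq_sqrt (hdR j).le]
  rw [h1, h2] at hcs
  refine hcs.trans (mul_le_mul_of_nonneg_right ?_ (Real.sqrt_nonneg _))
  refine Real.sqrt_le_iff.2 ⟨mul_nonneg (norm2Inf_nonneg _) (by positivity), ?_⟩
  -- Cauchy–Schwarz produces row `i`, while `norm2Inf` measures columns. Detailed balance exchanges
  -- them at the cost of degree ratios.
  have h3 : ∀ j, (B i j / √(G.degree j : ℝ)) ^ 2 ≤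
      (G.maxDegree / (G.minDegree : ℝ) ^ 2) * B j i ^ 2 := by
    intro j
    have h4 : B i j = G.degree j * B j i / G.degree i := by
      rw [eq_div_iff (hdR i).ne', mul_comm, hB, degree_mul_laplacian_sq hd]
    have h5 : (G.degree j : ℝ) ≤ G.maxDegree := by exact_mod_cast G.degree_le_maxDegree j
    rw [div_pow, Real.sq_sqrt (hdR j).le, h4]
    have h6 : (↑(G.degree j) * B j i / ↑(G.degree i)) ^ 2 / ↑(G.degree j) =
        (G.degree j / (G.degree i : ℝ) ^ 2) * B j i ^ 2 := by
      have := (hdR i).ne'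
      have := (hdR j).ne'
      field_simp
    rw [h6]
    refine mul_le_mul_of_nonneg_right ?_ (sq_nonneg _)
    exact div_le_div₀ (Nat.cast_nonneg _) h5 (by positivity)
      (pow_le_pow_left₀ hmin.le hmini 2)
  refine (Finset.sum_le_sum fun j _ => h3 j).trans ?_
  rw [← Finset.mul_sum, mul_pow, div_pow, Real.sq_sqrt (Nat.cast_nonneg _), mul_comm]
  exact mul_le_mul_of_nonneg_right (column_sq_sum_le B i) (by positivity)

end TwoStep

/-! ### Perturbation analysis of the stationary distribution. -/

section Perturbation

/-- The deviation of the win fractions from the Bradley-Terry-Luce probabilities. -/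
noncomputable def noise {n : ℕ} (w : Fin n → ℝ) (y : Fin n → Fin n → ℝ) (i j : Fin n) : ℝ :=
  y i j - w i / (w i + w j)

lemma noise_swap {n : ℕ} {w : Fin n → ℝ} {y : Fin n → Fin n → ℝ} (hw0 : ∀ i, 0 < w i)
    {i j : Fin n} (h : y j i = 1 - y i j) : noise w y j i = -noise w y i j := by
  have := (add_pos (hw0 i) (hw0 j)).ne'
  have := (add_pos (hw0 j) (hw0 i)).ne'
  simp only [noise, h]
  field_simp
  ring

variable {n : ℕ} {G : SimpleGraph (Fin n)} [DecidableRel G.Adj] {y : Fin n → Fin n → ℝ}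
  {w : Fin n → ℝ} {b : ℝ}

lemma one_div_le_win_prob (hb : 1 ≤ b) (hw0 : ∀ i, 0 < w i) (hw1 : ∀ i, w i ≤ 1)
    (hwb : ∀ i, 1 ≤ b * w i) (i j : Fin n) : 1 / (2 * b) ≤ w i / (w i + w j) := by
  have hij := add_pos (hw0 i) (hw0 j)
  rw [div_le_div_iff₀ (by linarith) hij]
  nlinarith [hwb i, hw1 i, hw1 j]

/-- The quantity is half the harmonic mean of two scores, each at least `1 / b`. -/
lemma one_div_le_conductance (hb : 1 ≤ b) (hw0 : ∀ i, 0 < w i)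
    (hwb : ∀ i, 1 ≤ b * w i) (i j : Fin n) : 1 / (2 * b) ≤ w i * w j / (w i + w j) := by
  have hij := add_pos (hw0 i) (hw0 j)
  rw [div_le_div_iff₀ (by linarith) hij]
  nlinarith [mul_le_mul_of_nonneg_left (hwb i) (hw0 j).le,
    mul_le_mul_of_nonneg_left (hwb j) (hw0 i).le]

/-- An item that wins some comparison has a self-loop in the chain, even at a vertex of maximum
degree; this supplies the aperiodicity for the power method. -/
lemma win_sum_pos (hb : 1 ≤ b) (hw0 : ∀ i, 0 < w i) (hw1 : ∀ i, w i ≤ 1)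
    (hwb : ∀ i, 1 ≤ b * w i) {i : Fin n} (hd : 0 < G.degree i)
    (hnoise : |∑ j ∈ G.neighborFinset i, noise w y i j| ≤ 1 / (8 * b) * G.degree i) :
    0 < ∑ j ∈ G.neighborFinset i, y i j := by
  have hdR : (0 : ℝ) < G.degree i := by exact_mod_cast hd
  have h1 : ∑ j ∈ G.neighborFinset i, y i j =
      ∑ j ∈ G.neighborFinset i, w i / (w i + w j) + ∑ j ∈ G.neighborFinset i, noise w y i j := by
    rw [← Finset.sum_add_distrib]
    exact Finset.sum_congr rfl fun j _ => by simp [noise]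
  have h2 : (G.degree i : ℝ) * (1 / (2 * b)) ≤ ∑ j ∈ G.neighborFinset i, w i / (w i + w j) := by
    have := Finset.card_nsmul_le_sum (G.neighborFinset i) (fun j => w i / (w i + w j))
      (1 / (2 * b)) fun j _ => one_div_le_win_prob hb hw0 hw1 hwb i j
    simpa [nsmul_eq_mul] using this
  have h3 := neg_le_of_abs_le hnoise
  have h4 : 1 / (8 * b) * G.degree i < G.degree i * (1 / (2 * b)) := by
    rw [mul_comm]
    exact mul_lt_mul_of_pos_left (one_div_lt_one_div_of_lt (by linarith) (by linarith)) hdR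
  rw [h1]
  linarith

/-- One step of the perturbation recursion: relative errors are controlled by those at the
neighbors. -/
lemma relative_error_step (hb : 1 ≤ b) (hw0 : ∀ i, 0 < w i) (hw1 : ∀ i, w i ≤ 1)
    (hwb : ∀ i, 1 ≤ b * w i) (hy : ∀ i j, 0 ≤ y i j)
    (hswap : ∀ i j, G.Adj i j → y j i = 1 - y i j) {h : Fin n → ℝ} {i : Fin n}
    (hd : 0 < G.degree i)
    (hbal : ∑ j ∈ G.neighborFinset i,
      (y i j * (w j * (1 + h j)) - y j i * (w i * (1 + h i))) = 0)
    (hnoise : |∑ j ∈ G.neighborFinset i, noise w y i j| ≤ 1 / (8 * b) * G.degree i)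
    {τ : ℝ} (hτ : |∑ j ∈ G.neighborFinset i, noise w y i j * (w i + w j)| ≤
      τ * √(G.degree i : ℝ)) :
    |h i| ≤ 4 * b * (laplacian G *ᵥ fun j => |h j|) i + 4 * b * (τ / √(G.degree i : ℝ)) := by
  have hdR : (0 : ℝ) < G.degree i := by exact_mod_cast hd
  have hadj : ∀ j ∈ G.neighborFinset i, G.Adj i j := fun j hj => (G.mem_neighborFinset i j).1 hj
  set W := ∑ j ∈ G.neighborFinset i, y j i * w i with hW
  have hkey : W * h i = ∑ j ∈ G.neighborFinset i, y i j * w j * h j +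
      ∑ j ∈ G.neighborFinset i, noise w y i j * (w i + w j) := by
    rw [hW, Finset.sum_mul, ← Finset.sum_add_distrib, ← sub_eq_zero, ← Finset.sum_sub_distrib,
      ← neg_eq_zero, ← Finset.sum_neg_distrib, ← hbal]
    refine Finset.sum_congr rfl fun j hj => ?_
    have := (add_pos (hw0 i) (hw0 j)).ne'
    simp only [noise, hswap i j (hadj j hj)]
    field_simp
    ring
  -- The mean of `W` is at least `degree / (2 * b)` and the noise removes at most `degree / (8 *
  -- b)`.
  have hWlow : G.degree i / (4 * b) ≤ W := by
    have h1 : W = ∑ j ∈ G.neighborFinset i, w i * w j / (w i + w j) -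
        w i * ∑ j ∈ G.neighborFinset i, noise w y i j := by
      rw [hW, Finset.mul_sum, ← Finset.sum_sub_distrib]
      refine Finset.sum_congr rfl fun j hj => ?_
      have := (add_pos (hw0 i) (hw0 j)).ne'
      simp only [noise, hswap i j (hadj j hj)]
      field_simp
      ring
    have h2 : (G.degree i : ℝ) * (1 / (2 * b)) ≤
        ∑ j ∈ G.neighborFinset i, w i * w j / (w i + w j) := by
      have := Finset.card_nsmul_le_sum (G.neighborFinset i) (fun j => w i * w j / (w i + w j))
        (1 / (2 * b)) fun j _ => one_div_le_conductance hb hw0 hwb i j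
      simpa [nsmul_eq_mul] using this
    have h3 : w i * ∑ j ∈ G.neighborFinset i, noise w y i j ≤ 1 / (8 * b) * G.degree i := by
      refine (le_abs_self _).trans ?_
      rw [abs_mul, abs_of_pos (hw0 i)]
      exact (mul_le_of_le_one_left (abs_nonneg _) (hw1 i)).trans hnoise
    have hb0 : 0 < b := by linarith
    have h4 : (G.degree i : ℝ) / (4 * b) + 1 / (8 * b) * G.degree i ≤
        (G.degree i : ℝ) * (1 / (2 * b)) := by
      have : (G.degree i : ℝ) * (1 / (2 * b)) - G.degree i / (4 * b) - 1 / (8 * b) * G.degree i =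
          G.degree i / (8 * b) := by
        field_simp
        ring
      have h5 : 0 ≤ (G.degree i : ℝ) / (8 * b) := by positivity
      linarith
    rw [h1]
    linarith
  have habs : W * |h i| ≤ ∑ j ∈ G.neighborFinset i, |h j| + τ * √(G.degree i : ℝ) := by
    have hW0 : 0 ≤ W := le_trans (by have : 0 < b := by linarith
                                     positivity) hWlow
    rw [← abs_of_nonneg hW0, ← abs_mul, hkey]
    refine (abs_add_le _ _).trans (add_le_add ?_ hτ)
    refine (Finset.abs_sum_le_sum_abs _ _).trans (Finset.sum_le_sum fun j hj => ?_)
    rw [abs_mul, abs_mul, abs_of_nonneg (hy i j), abs_of_pos (hw0 j)]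
    have hy1 : y i j ≤ 1 := by linarith [hy j i, hswap i j (hadj j hj)]
    exact mul_le_of_le_one_left (abs_nonneg _) (mul_le_one₀ hy1 (hw0 j).le (hw1 j))
  have h5 : G.degree i / (4 * b) * |h i| ≤
      ∑ j ∈ G.neighborFinset i, |h j| + τ * √(G.degree i : ℝ) :=
    (mul_le_mul_of_nonneg_right hWlow (abs_nonneg _)).trans habs
  have hb0 : 0 < b := by linarith
  have hs := (Real.sqrt_pos.2 hdR).ne'
  have h6 : τ / √(G.degree i : ℝ) = τ * √(G.degree i : ℝ) / G.degree i := by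
    rw [div_eq_div_iff hs hdR.ne', mul_assoc, Real.mul_self_sqrt hdR.le]
  rw [laplacian_mulVec, h6]
  calc |h i| = 4 * b / G.degree i * (G.degree i / (4 * b) * |h i|) := by field_simp
    _ ≤ 4 * b / G.degree i * (∑ j ∈ G.neighborFinset i, |h j| + τ * √(G.degree i : ℝ)) :=
        mul_le_mul_of_nonneg_left h5 (by positivity)
    _ = _ := by ring

/-- The energy estimate: the relative errors are small in degree-weighted `ℓ²`. -/
lemma relative_error_energy (hb : 1 ≤ b) (hw0 : ∀ i, 0 < w i) (hw1 : ∀ i, w i ≤ 1)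
    (hwb : ∀ i, 1 ≤ b * w i) (hswap : ∀ i j, G.Adj i j → y j i = 1 - y i j) {γ : ℝ} (hγ : 0 < γ)
    {h : Fin n → ℝ}
    (hpoin : γ * ∑ i, (G.degree i : ℝ) * h i ^ 2 ≤
        1 / 2 * ∑ i, ∑ j ∈ G.neighborFinset i, (h i - h j) ^ 2)
    (hbal : ∀ i, ∑ j ∈ G.neighborFinset i,
      (y i j * (w j * (1 + h j)) - y j i * (w i * (1 + h i))) = 0)
    (hE : ∀ i, |∑ j ∈ G.neighborFinset i, noise w y i j| ≤ γ / (8 * b) * G.degree i)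
    {τ : ℝ} (hτ0 : 0 ≤ τ) (hτ : ∀ i, |∑ j ∈ G.neighborFinset i, noise w y i j * (w i + w j)| ≤
      τ * √(G.degree i : ℝ))
    (hform : |∑ i, ∑ j ∈ G.neighborFinset i, noise w y i j * w j * (h i * h j)| ≤
      γ / (8 * b) * ∑ i, (G.degree i : ℝ) * h i ^ 2) :
    √(∑ i, (G.degree i : ℝ) * h i ^ 2) ≤ 4 * b * τ * √n / γ := by
  set S := ∑ i, (G.degree i : ℝ) * h i ^ 2 with hS
  have hS0 : 0 ≤ S := Finset.sum_nonneg fun i _ => by positivity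
  have hb0 : 0 < b := by linarith
  have hadj : ∀ i, ∀ j ∈ G.neighborFinset i, G.Adj i j :=
    fun i j hj => (G.mem_neighborFinset i j).1 hj
  set s : Fin n → Fin n → ℝ := fun i j => w i * w j / (w i + w j) with hs
  have hsymm : ∑ i, ∑ j ∈ G.neighborFinset i, s i j * (h i - h j) * h i =
      1 / 2 * ∑ i, ∑ j ∈ G.neighborFinset i, s i j * (h i - h j) ^ 2 := by
    have h1 := sum_neighborFinset_swap G (fun i j => s i j * (h i - h j) * h i)
    have h2 : ∑ i, ∑ j ∈ G.neighborFinset i, s i j * (h i - h j) ^ 2 =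
        ∑ i, ∑ j ∈ G.neighborFinset i, s i j * (h i - h j) * h i +
        ∑ i, ∑ j ∈ G.neighborFinset i, s j i * (h j - h i) * h j := by
      rw [← Finset.sum_add_distrib]
      refine Finset.sum_congr rfl fun i _ => ?_
      rw [← Finset.sum_add_distrib]
      refine Finset.sum_congr rfl fun j _ => ?_
      have : s j i = s i j := by simp only [hs, mul_comm, add_comm]
      rw [this]
      ring
    rw [h2, ← h1]
    ring
  have hlow : γ / (2 * b) * S ≤ ∑ i, ∑ j ∈ G.neighborFinset i, s i j * (h i - h j) * h i := by
    rw [hsymm]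
    have h1 : 1 / (2 * b) * ∑ i, ∑ j ∈ G.neighborFinset i, (h i - h j) ^ 2 ≤
        ∑ i, ∑ j ∈ G.neighborFinset i, s i j * (h i - h j) ^ 2 := by
      rw [Finset.mul_sum]
      refine Finset.sum_le_sum fun i _ => ?_
      rw [Finset.mul_sum]
      exact Finset.sum_le_sum fun j _ => mul_le_mul_of_nonneg_right
        (one_div_le_conductance hb hw0 hwb i j) (sq_nonneg _)
    calc γ / (2 * b) * S = 1 / (2 * b) * (γ * S) := by ring
      _ ≤ 1 / (2 * b) * (1 / 2 * ∑ i, ∑ j ∈ G.neighborFinset i, (h i - h j) ^ 2) :=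
          mul_le_mul_of_nonneg_left hpoin (by positivity)
      _ = 1 / 2 * (1 / (2 * b) * ∑ i, ∑ j ∈ G.neighborFinset i, (h i - h j) ^ 2) := by ring
      _ ≤ _ := mul_le_mul_of_nonneg_left h1 (by norm_num)
  -- The balance equations are multiplied by `h i` and summed. The noise splits into a part linear
  -- in `h`, a diagonal quadratic part and an off-diagonal quadratic part.
  have hexp : ∑ i, ∑ j ∈ G.neighborFinset i, s i j * (h i - h j) * h i =
      ∑ i, h i * ∑ j ∈ G.neighborFinset i, noise w y i j * (w i + w j) +
      ∑ i, w i * h i ^ 2 * ∑ j ∈ G.neighborFinset i, noise w y i j +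
      ∑ i, ∑ j ∈ G.neighborFinset i, noise w y i j * w j * (h i * h j) := by
    rw [← Finset.sum_add_distrib, ← Finset.sum_add_distrib]
    refine Finset.sum_congr rfl fun i _ => ?_
    have h1 := congrArg (fun x => h i * x) (hbal i)
    simp only [mul_zero] at h1
    rw [← add_zero (∑ j ∈ G.neighborFinset i, s i j * (h i - h j) * h i), ← h1]
    simp only [Finset.mul_sum]
    rw [← Finset.sum_add_distrib, ← Finset.sum_add_distrib, ← Finset.sum_add_distrib]
    refine Finset.sum_congr rfl fun j hj => ?_
    have := (add_pos (hw0 i) (hw0 j)).ne'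
    simp only [noise, hs, hswap i j (hadj i j hj)]
    field_simp
    ring
  have hT1 : ∑ i, h i * ∑ j ∈ G.neighborFinset i, noise w y i j * (w i + w j) ≤
      τ * √n * √S := by
    have h1 : ∑ i, h i * ∑ j ∈ G.neighborFinset i, noise w y i j * (w i + w j) ≤
        ∑ i, τ * (√(G.degree i : ℝ) * |h i|) := by
      refine Finset.sum_le_sum fun i _ => ?_
      refine (le_abs_self _).trans ?_
      rw [abs_mul]
      exact (mul_le_mul_of_nonneg_left (hτ i) (abs_nonneg _)).trans_eq (by ring)
    refine h1.trans ?_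
    rw [← Finset.mul_sum, mul_assoc]
    refine mul_le_mul_of_nonneg_left ?_ hτ0
    have h2 := Real.sum_mul_le_sqrt_mul_sqrt Finset.univ (fun _ : Fin n => (1 : ℝ))
      (fun i => √(G.degree i : ℝ) * |h i|)
    simp only [one_mul, one_pow, mul_pow, sq_abs, Real.sq_sqrt (Nat.cast_nonneg _),
      Finset.sum_const, Finset.card_univ, Fintype.card_fin, nsmul_eq_mul, mul_one] at h2
    exact h2
  have hT2 : ∑ i, w i * h i ^ 2 * ∑ j ∈ G.neighborFinset i, noise w y i j ≤ γ / (8 * b) * S := by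
    rw [hS, Finset.mul_sum]
    refine Finset.sum_le_sum fun i _ => ?_
    refine (le_abs_self _).trans ?_
    rw [abs_mul, abs_of_nonneg (mul_nonneg (hw0 i).le (sq_nonneg _))]
    calc _ ≤ w i * h i ^ 2 * (γ / (8 * b) * G.degree i) :=
          mul_le_mul_of_nonneg_left (hE i) (mul_nonneg (hw0 i).le (sq_nonneg _))
      _ = w i * (γ / (8 * b) * (G.degree i * h i ^ 2)) := by ring
      _ ≤ _ := mul_le_of_le_one_left (by positivity) (hw1 i)
  have hT3 := (le_abs_self _).trans hform
  -- Each of the two quadratic parts uses up `γ / (8 * b) * S` of the lower bound `γ / (2 * b) * S`.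
  have hmain : γ / (4 * b) * S ≤ τ * √n * √S := by
    have h1 : γ / (2 * b) * S = γ / (4 * b) * S + γ / (8 * b) * S + γ / (8 * b) * S := by
      field_simp
      ring
    linarith
  rcases (Real.sqrt_nonneg S).eq_or_lt with h0 | h0
  · rw [← h0]; positivity
  · have h1 : γ / (4 * b) * √S ≤ τ * √n := by
      refine le_of_mul_le_mul_right ?_ h0
      rwa [mul_assoc, Real.mul_self_sqrt hS0]
    rw [le_div_iff₀ hγ]
    calc √S * γ = 4 * b * (γ / (4 * b) * √S) := by field_simp
      _ ≤ 4 * b * (τ * √n) := mul_le_mul_of_nonneg_left h1 (by positivity)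
      _ = _ := by ring

/-- Uniform bound on the relative errors. -/
theorem relative_error_le (hn : 0 < n) (hd : ∀ i, 0 < G.degree i) (hb : 1 ≤ b)
    (hw0 : ∀ i, 0 < w i) (hw1 : ∀ i, w i ≤ 1)
    (hwb : ∀ i, 1 ≤ b * w i) (hy : ∀ i j, 0 ≤ y i j)
    (hswap : ∀ i j, G.Adj i j → y j i = 1 - y i j) {γ : ℝ} (hγ : 0 < γ) (hγ1 : γ ≤ 1)
    {h : Fin n → ℝ}
    (hpoin : γ * ∑ i, (G.degree i : ℝ) * h i ^ 2 ≤
        1 / 2 * ∑ i, ∑ j ∈ G.neighborFinset i, (h i - h j) ^ 2)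
    (hbal : ∀ i, ∑ j ∈ G.neighborFinset i,
      (y i j * (w j * (1 + h j)) - y j i * (w i * (1 + h i))) = 0)
    (hE : ∀ i, |∑ j ∈ G.neighborFinset i, noise w y i j| ≤ γ / (8 * b) * G.degree i)
    {τ : ℝ} (hτ0 : 0 ≤ τ) (hτ : ∀ i, |∑ j ∈ G.neighborFinset i, noise w y i j * (w i + w j)| ≤
      τ * √(G.degree i : ℝ))
    (hform : |∑ i, ∑ j ∈ G.neighborFinset i, noise w y i j * w j * (h i * h j)| ≤
      γ / (8 * b) * ∑ i, (G.degree i : ℝ) * h i ^ 2) (i : Fin n) :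
    |h i| ≤ 84 * b ^ 3 * (√n * G.maxDegree / (γ * G.minDegree) * norm2Inf (laplacian G ^ 2)) *
      (τ / √G.maxDegree) := by
  have hb0 : 0 < b := by linarith
  have hdR : ∀ j, (0 : ℝ) < G.degree j := fun j => by exact_mod_cast hd j
  have hmini : ∀ j, (G.minDegree : ℝ) ≤ G.degree j := fun j => by
    exact_mod_cast G.minDegree_le_degree j
  have hmaxi : (G.degree i : ℝ) ≤ G.maxDegree := by exact_mod_cast G.degree_le_maxDegree i
  have hmin : (0 : ℝ) < G.minDegree := by
    have : Nonempty (Fin n) := ⟨i⟩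
    obtain ⟨k, hk⟩ := G.exists_minimal_degree_vertex
    rw [hk]; exact hdR k
  have hmm : (G.minDegree : ℝ) ≤ G.maxDegree := (hmini i).trans hmaxi
  have hmax : (0 : ℝ) < G.maxDegree := hmin.trans_le hmm
  have henergy := relative_error_energy hb hw0 hw1 hwb hswap hγ hpoin hbal hE hτ0 hτ hform
  set N := norm2Inf (laplacian G ^ 2) with hN
  have hN0 : 0 ≤ N := norm2Inf_nonneg _
  set a : Fin n → ℝ := fun j => |h j| with ha
  set τ' := τ / √(G.minDegree : ℝ) with hτ'
  have hsmin : 0 < √(G.minDegree : ℝ) := Real.sqrt_pos.2 hmin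
  have hsmax : 0 < √(G.maxDegree : ℝ) := Real.sqrt_pos.2 hmax
  have hsn : 0 < √(n : ℝ) := Real.sqrt_pos.2 (by exact_mod_cast hn)
  have hstep : ∀ j, a j ≤ 4 * b * (laplacian G *ᵥ a) j + 4 * b * τ' := by
    intro j
    have hEj : |∑ k ∈ G.neighborFinset j, noise w y j k| ≤ 1 / (8 * b) * G.degree j :=
      (hE j).trans (mul_le_mul_of_nonneg_right
        (div_le_div_of_nonneg_right hγ1 (by positivity)) (hdR j).le)
    have h1 := relative_error_step hb hw0 hw1 hwb hy hswap (hd j) (hbal j) hEj (hτ j)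
    refine h1.trans (add_le_add le_rfl (mul_le_mul_of_nonneg_left ?_ (by positivity)))
    exact div_le_div_of_nonneg_left hτ0 hsmin (Real.sqrt_le_sqrt (hmini j))
  -- Inserting the one-step bound into itself gives the noise terms `16 * b ^ 2 * τ'` and `4 * b *
  -- τ'`, and `b ≤ b ^ 2`.
  have htwo : a i ≤ 16 * b ^ 2 * ((laplacian G ^ 2) *ᵥ a) i + 20 * b ^ 2 * τ' := by
    have h1 := laplacian_mulVec_mono (G := G) hstep i
    have h2 : (laplacian G *ᵥ fun j => 4 * b * (laplacian G *ᵥ a) j + 4 * b * τ') i =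
        4 * b * ((laplacian G ^ 2) *ᵥ a) i + 4 * b * τ' := by
      have h3 : (fun j => 4 * b * (laplacian G *ᵥ a) j + 4 * b * τ') =
          (4 * b) • (laplacian G *ᵥ a) + fun _ => 4 * b * τ' := by
        ext j; simp
      rw [h3, mulVec_add, mulVec_smul, mulVec_mulVec, laplacian_mulVec_const hd, ← sq]
      simp
    rw [h2] at h1
    have h4 := (hstep i).trans (add_le_add_left
      (mul_le_mul_of_nonneg_left h1 (by positivity : 0 ≤ 4 * b)) _)
    have h5 : 0 ≤ τ' := by positivity
    have h6 : b * τ' ≤ b ^ 2 * τ' := by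
      refine mul_le_mul_of_nonneg_right ?_ h5
      nlinarith
    nlinarith
  have hsq := laplacian_sq_mulVec_le hd a i
  have hS : ∑ j, (G.degree j : ℝ) * a j ^ 2 = ∑ j, (G.degree j : ℝ) * h j ^ 2 := by
    simp only [ha, sq_abs]
  rw [hS] at hsq
  have hsq' := hsq.trans (mul_le_mul_of_nonneg_left henergy
    (mul_nonneg hN0 (div_nonneg hsmax.le hmin.le)))
  have hNn : 1 ≤ √(n : ℝ) * N := by
    have h1 := one_le_card_mul_norm2Inf_sq hn hd
    have h2 : (√(n : ℝ) * N) ^ 2 = n * N ^ 2 := by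
      rw [mul_pow, Real.sq_sqrt (Nat.cast_nonneg _)]
    nlinarith [mul_nonneg hsn.le hN0]
  have hmaxsq := Real.mul_self_sqrt hmax.le
  have hminsq := Real.mul_self_sqrt hmin.le
  set R := √n * G.maxDegree / (γ * G.minDegree) * N * (τ / √(G.maxDegree : ℝ)) with hR
  have hfirst : N * (√(G.maxDegree : ℝ) / G.minDegree) * (4 * b * τ * √n / γ) = 4 * b * R := by
    rw [hR]
    nth_rewrite 2 [← hmaxsq]
    field_simp
  -- The local noise is dominated because `√n * N`, `1 / γ` and the degree ratio are all at least
  -- one. With `hfirst` this yields `16 * 4 + 20 = 84`.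
  have hsecond : τ' ≤ R := by
    have h1 : R = (√(n : ℝ) * N) * (1 / γ) * (√(G.maxDegree : ℝ) / √(G.minDegree : ℝ)) * τ' := by
      rw [hR, hτ']
      nth_rewrite 1 [← hmaxsq]
      rw [← hminsq]
      rw [Real.sqrt_mul_self hsmin.le]
      field_simp
    rw [h1]
    refine le_mul_of_one_le_left (by positivity) ?_
    refine one_le_mul_of_one_le_of_one_le (one_le_mul_of_one_le_of_one_le hNn ?_) ?_
    · rwa [one_le_div hγ]
    · rw [one_le_div hsmin]; exact Real.sqrt_le_sqrt hmm
  have hR0 : 0 ≤ R := by positivity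
  rw [hfirst] at hsq'
  have hb3 : b ^ 2 ≤ b ^ 3 := by nlinarith [sq_nonneg b]
  calc |h i| ≤ 16 * b ^ 2 * ((laplacian G ^ 2) *ᵥ a) i + 20 * b ^ 2 * τ' := htwo
    _ ≤ 16 * b ^ 2 * (4 * b * R) + 20 * b ^ 2 * R :=
        add_le_add (mul_le_mul_of_nonneg_left hsq' (by positivity))
          (mul_le_mul_of_nonneg_left hsecond (by positivity))
    _ ≤ 64 * b ^ 3 * R + 20 * b ^ 3 * R := by nlinarith [mul_le_mul_of_nonneg_right hb3 hR0]
    _ = _ := by rw [hR]; ring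

end Perturbation

/-! ### Recovery of the top items from noise bounds. -/

section Deterministic

variable {n : ℕ} {G : SimpleGraph (Fin n)} [DecidableRel G.Adj] {y : Fin n → Fin n → ℝ}
  {w : Fin n → ℝ} {b : ℝ}

/-- If the noise is small, then every stationary distribution is proportional to the scores up to
small relative errors. -/
theorem isStationary_close (hn : 0 < n) (hd : ∀ i, 0 < G.degree i) (hb : 1 ≤ b)
    (hw0 : ∀ i, 0 < w i) (hw1 : ∀ i, w i ≤ 1) (hwb : ∀ i, 1 ≤ b * w i) (hy : ∀ i j, 0 ≤ y i j)
    (hswap : ∀ i j, G.Adj i j → y j i = 1 - y i j)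
    (hγ : 0 < spectralGap (laplacian G))
    (hE : ∀ i, |∑ j ∈ G.neighborFinset i, noise w y i j| ≤
      spectralGap (laplacian G) / (8 * b) * G.degree i)
    {τ : ℝ} (hτ0 : 0 ≤ τ) (hτ : ∀ i, |∑ j ∈ G.neighborFinset i, noise w y i j * (w i + w j)| ≤
      τ * √(G.degree i : ℝ))
    (hform : ∀ h : Fin n → ℝ,
      |∑ i, ∑ j ∈ G.neighborFinset i, noise w y i j * w j * (h i * h j)| ≤
        spectralGap (laplacian G) / (8 * b) * ∑ i, (G.degree i : ℝ) * h i ^ 2)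
    {p : Fin n → ℝ} (hp : IsStationary (transitionMatrix G y) p) :
    ∃ (c : ℝ) (h : Fin n → ℝ), 0 < c ∧ (∀ i, p i = c * (w i * (1 + h i))) ∧
      ∀ i, |h i| ≤ 84 * b ^ 3 * (√n * G.maxDegree / (spectralGap (laplacian G) * G.minDegree) *
        norm2Inf (laplacian G ^ 2)) * (τ / √G.maxDegree) := by
  have hdR : ∀ j, (0 : ℝ) < G.degree j := fun j => by exact_mod_cast hd j
  have hdmax : 0 < G.maxDegree := (hd ⟨0, hn⟩).trans_le (G.degree_le_maxDegree _)
  obtain ⟨hγ1, hpoin⟩ := spectralGap_le_one_and_poincare hn hd hγ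
  obtain ⟨hp0, hp1, hpfix⟩ := hp
  have hD : 0 < ∑ i, (G.degree i : ℝ) :=
    Finset.sum_pos (fun i _ => hdR i) ⟨⟨0, hn⟩, Finset.mem_univ _⟩
  have hU : 0 < ∑ i, (G.degree i : ℝ) * (p i / w i) := by
    obtain ⟨i, hi⟩ : ∃ i, p i ≠ 0 := by
      by_contra! h
      simp [h] at hp1
    refine Finset.sum_pos' (fun i _ => mul_nonneg (hdR i).le (div_nonneg (hp0 i) (hw0 i).le))
      ⟨i, Finset.mem_univ i, mul_pos (hdR i) (div_pos ((hp0 i).lt_of_ne' hi) (hw0 i))⟩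
  -- The degree-weighted mean of `p / w`; this normalization gives `h` weighted mean zero, as the
  -- Poincaré inequality requires.
  set c := (∑ i, (G.degree i : ℝ) * (p i / w i)) / ∑ i, (G.degree i : ℝ) with hc
  have hc0 : 0 < c := div_pos hU hD
  set h : Fin n → ℝ := fun i => p i / w i / c - 1 with hh
  have hpc : ∀ i, p i = c * (w i * (1 + h i)) := by
    intro i
    have := (hw0 i).ne'
    have := hc0.ne'
    simp only [hh]
    field_simp
    ring
  have hmean : ∑ i, (G.degree i : ℝ) * h i = 0 := by
    have h1 : ∀ i, (G.degree i : ℝ) * h i = G.degree i * (p i / w i) / c - G.degree i := by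
      intro i; simp only [hh]; ring
    simp only [h1]
    rw [Finset.sum_sub_distrib, ← Finset.sum_div, sub_eq_zero, div_eq_iff hc0.ne', hc,
      mul_div_cancel₀ _ hD.ne']
  have hbal : ∀ i, ∑ j ∈ G.neighborFinset i,
      (y i j * (w j * (1 + h j)) - y j i * (w i * (1 + h i))) = 0 := by
    intro i
    have h1 := flow_balance hdmax hpfix i
    have h2 : ∑ j ∈ G.neighborFinset i, (y i j * p j - y j i * p i) =
        c * ∑ j ∈ G.neighborFinset i,
          (y i j * (w j * (1 + h j)) - y j i * (w i * (1 + h i))) := by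
      rw [Finset.mul_sum]
      refine Finset.sum_congr rfl fun j _ => ?_
      rw [hpc i, hpc j]
      ring
    rw [h2] at h1
    exact (mul_eq_zero.1 h1).resolve_left hc0.ne'
  exact ⟨c, h, hc0, hpc, relative_error_le hn hd hb hw0 hw1 hwb hy hswap hγ hγ1 (hpoin h hmean)
    hbal hE hτ0 hτ (hform h)⟩

/-- If the noise is small compared to the separation, Rank Centrality finds the top items. -/
theorem returns_of_noise_bounds (hn : 0 < n) (hd : ∀ i, 0 < G.degree i) (hb : 1 ≤ b)
    (hw0 : ∀ i, 0 < w i) (hw1 : ∀ i, w i ≤ 1) (hwb : ∀ i, 1 ≤ b * w i) (hy : ∀ i j, 0 ≤ y i j)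
    (hswap : ∀ i j, G.Adj i j → y j i = 1 - y i j)
    (hγ : 0 < spectralGap (laplacian G))
    (hE : ∀ i, |∑ j ∈ G.neighborFinset i, noise w y i j| ≤
      spectralGap (laplacian G) / (8 * b) * G.degree i)
    {τ : ℝ} (hτ0 : 0 ≤ τ) (hτ : ∀ i, |∑ j ∈ G.neighborFinset i, noise w y i j * (w i + w j)| ≤
      τ * √(G.degree i : ℝ))
    (hform : ∀ h : Fin n → ℝ,
      |∑ i, ∑ j ∈ G.neighborFinset i, noise w y i j * w j * (h i * h j)| ≤
        spectralGap (laplacian G) / (8 * b) * ∑ i, (G.degree i : ℝ) * h i ^ 2)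
    {Δ : ℝ} (hΔ : Δ ≤ 1)
    (hsmall : 84 * b ^ 3 * (√n * G.maxDegree / (spectralGap (laplacian G) * G.minDegree) *
        norm2Inf (laplacian G ^ 2)) * (τ / √G.maxDegree) < Δ / 2)
    {S : Finset (Fin n)} (hsep : ∀ i ∈ S, ∀ j ∉ S, Δ ≤ w i - w j) :
    Returns G y S.card S := by
  have hγ1 := (spectralGap_le_one_and_poincare hn hd hγ).1
  have hb0 : 0 < b := by linarith
  have hclose := fun p hp => isStationary_close hn hd hb hw0 hw1 hwb hy hswap hγ hE hτ0 hτ hform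
    (p := p) hp
  have hdiag : ∀ i, 0 < transitionMatrix G y i i := by
    intro i
    refine transitionMatrix_diag_pos hswap (hd i) (win_sum_pos hb hw0 hw1 hwb (hd i) ?_)
    exact (hE i).trans (mul_le_mul_of_nonneg_right
      (div_le_div_of_nonneg_right hγ1 (by positivity)) (Nat.cast_nonneg _))
  obtain ⟨p, hp, huniq, hlim⟩ := power_method_converges hn (transitionMatrix_nonneg hy hdiag)
    transitionMatrix_column_sum hdiag fun p hp i => by
      obtain ⟨c, h, hc, hpc, hh⟩ := hclose p hp
      have h1 := abs_lt.1 ((hh i).trans_lt hsmall)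
      rw [hpc]
      exact mul_pos hc (mul_pos (hw0 i) (by linarith))
  refine ⟨p, hp, huniq, hlim, rfl, fun i hi j hj => ?_⟩
  obtain ⟨c, h, hc, hpc, hh⟩ := hclose p hp
  have hi' := abs_lt.1 ((hh i).trans_lt hsmall)
  have hj' := abs_lt.1 ((hh j).trans_lt hsmall)
  have hij := hsep i hi j hj
  rw [hpc i, hpc j]
  refine mul_lt_mul_of_pos_left ?_ hc
  have hΔ0 : 0 < Δ := by linarith
  have h1 : w i * (-(Δ / 2)) < w i * h i := mul_lt_mul_of_pos_left hi'.1 (hw0 i)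
  have h2 : w j * h j < w j * (Δ / 2) := mul_lt_mul_of_pos_left hj'.2 (hw0 j)
  -- The errors cost strictly less than `(w i + w j) * Δ / 2`, which is at most `Δ` because the
  -- scores are at most one.
  nlinarith [hw1 i, hw1 j]

end Deterministic

/-! ### Concentration of the comparison noise. -/

section Random

lemma winFraction_swap {n : ℕ} {G : SimpleGraph (Fin n)} {w : Fin n → ℝ} {L : ℕ} {Ω : Type*}
    [MeasurableSpace Ω] {μ : Measure Ω} {Y : Fin n → Fin n → Fin L → Ω → Bool} (hL : 0 < L) (hY : IsBTLSample G w L μ Y) (ω : Ω) (i j : Fin n)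
    (h : G.Adj i j) : winFraction Y ω j i = 1 - winFraction Y ω i j := by
  have hL' : (L : ℝ) ≠ 0 := by exact_mod_cast hL.ne'
  have h1 : ∀ l, (if Y j i l ω = true then (1 : ℝ) else 0) =
      1 - if Y i j l ω = true then (1 : ℝ) else 0 := by
    intro l
    rw [hY.swap i j l ω h]
    cases Y i j l ω <;> simp
  simp only [winFraction, h1, Finset.sum_sub_distrib]
  simp
  field_simp

lemma winFraction_nonneg {n L : ℕ} {Ω : Type*} {Y : Fin n → Fin n → Fin L → Ω → Bool} (ω : Ω) (i j : Fin n) : 0 ≤ winFraction Y ω i j :=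
  mul_nonneg (by positivity) (Finset.sum_nonneg fun l _ => by split_ifs <;> norm_num)

variable {n : ℕ} {G : SimpleGraph (Fin n)} [DecidableRel G.Adj]

/-- Translates between the edges `i < j`, which index the independent coins, and the ordered
adjacent pairs of the vertex sums. -/
lemma sum_edges (f : Fin n → Fin n → ℝ) :
    ∑ e : {e : Fin n × Fin n // e.1 < e.2 ∧ G.Adj e.1 e.2},
      (f e.1.1 e.1.2 + f e.1.2 e.1.1) = ∑ i, ∑ j ∈ G.neighborFinset i, f i j := by
  have h1 : ∀ g : Fin n → Fin n → ℝ,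
      ∑ e : {e : Fin n × Fin n // e.1 < e.2 ∧ G.Adj e.1 e.2}, g e.1.1 e.1.2 =
        ∑ i, ∑ j, if i < j ∧ G.Adj i j then g i j else 0 := by
    intro g
    rw [← Fintype.sum_prod_type' (f := fun i j => if i < j ∧ G.Adj i j then g i j else 0),
      ← Finset.sum_filter]
    exact (Finset.sum_subtype _ (by simp) (fun e : Fin n × Fin n => g e.1 e.2)).symm
  rw [Finset.sum_add_distrib, h1 f, h1 fun i j => f j i,
    Finset.sum_comm (f := fun i j => if i < j ∧ G.Adj i j then f j i else 0),
    ← Finset.sum_add_distrib]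
  refine Finset.sum_congr rfl fun i _ => ?_
  rw [← Finset.sum_add_distrib, SimpleGraph.neighborFinset_eq_filter, Finset.sum_filter]
  refine Finset.sum_congr rfl fun j _ => ?_
  by_cases h : G.Adj i j
  · rcases lt_or_gt_of_ne h.ne with hij | hij
    · simp [h, hij, hij.not_gt]
    · simp [h, h.symm, hij, hij.not_gt]
  · have h' : ¬ G.Adj j i := fun k => h k.symm
    simp [h, h']

variable {w : Fin n → ℝ} {L : ℕ} {Ω : Type*} [MeasurableSpace Ω] {μ : Measure Ω}
  {Y : Fin n → Fin n → Fin L → Ω → Bool}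

/-- The tail bound at the scale `√(log n)`, in terms of the number `n` of items. -/
lemma tail_at_log_scale (hn : 2 ≤ n) {v t : ℝ} (hv : 0 < v)
    (ht : t ^ 2 = 169 * v * Real.log n) :
    (n : ℝ) * (⌈Real.log n⌉₊ * v / t ^ 2) ^ ⌈Real.log n⌉₊ ≤ ((n : ℝ) ^ 3)⁻¹ := by
  have hnR : (2 : ℝ) ≤ n := by exact_mod_cast hn
  have hn0 : (0 : ℝ) < n := by linarith
  have hlog2 : Real.log 2 ≤ Real.log n := Real.log_le_log (by norm_num) hnR
  have hlog : 1 / 2 < Real.log n := by linarith [Real.log_two_gt_d9]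
  set q := ⌈Real.log n⌉₊ with hq
  have hq1 : Real.log n ≤ q := Nat.le_ceil _
  have hq2 : (q : ℝ) < Real.log n + 1 := Nat.ceil_lt_add_one (by linarith)
  -- This fixes the constant `13`. As `log n > 1 / 2`, the ceiling is below `3 * log n`, so the base
  -- is at most `3 / 169 ≤ exp (-4)`; its `q`-th power is at most `n⁻⁴`, and the dimension costs one
  -- factor `n`.
  have hexp : Real.exp 4 ≤ 169 / 3 := by
    have h1 : Real.exp 4 = Real.exp 1 ^ 4 := by rw [← Real.exp_nat_mul]; norm_num
    have h2 := Real.exp_one_lt_d9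
    have h3 : Real.exp 1 ^ 4 ≤ (2.7182818286 : ℝ) ^ 4 :=
      pow_le_pow_left₀ (Real.exp_pos _).le h2.le 4
    rw [h1]
    exact h3.trans (by norm_num)
  have hbase : (q : ℝ) * v / t ^ 2 ≤ Real.exp (-4) := by
    rw [ht, Real.exp_neg, div_le_iff₀ (by positivity), ← div_eq_inv_mul,
      le_div_iff₀ (Real.exp_pos _)]
    calc (q : ℝ) * v * Real.exp 4 ≤ 3 * Real.log n * v * (169 / 3) := by
          refine mul_le_mul (mul_le_mul_of_nonneg_right (by linarith) hv.le) hexp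
            (Real.exp_pos _).le (by positivity)
      _ = _ := by ring
  have hpow : ((q : ℝ) * v / t ^ 2) ^ q ≤ ((n : ℝ) ^ 4)⁻¹ := by
    refine (pow_le_pow_left₀ (by positivity) hbase q).trans ?_
    rw [← Real.exp_nat_mul, ← Real.exp_log (by positivity : 0 < ((n : ℝ) ^ 4)⁻¹), Real.log_inv,
      Real.log_pow]
    refine Real.exp_le_exp.2 ?_
    push_cast
    linarith
  refine (mul_le_mul_of_nonneg_left hpow hn0.le).trans_eq ?_
  field_simp

/-- Concentration for matrices weighted by the noise of the edges. -/
theorem edge_form_tail_le [IsProbabilityMeasure μ] (hn : 2 ≤ n) (hL : 0 < L)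
    (hY : IsBTLSample G w L μ Y)
    {B : {e : Fin n × Fin n // e.1 < e.2 ∧ G.Adj e.1 e.2} → Matrix (Fin n) (Fin n) ℝ}
    (hB : ∀ e, (B e)ᵀ = B e) {v : ℝ} (hv0 : 0 < v)
    (hv : ∀ z, ∑ e, (B e *ᵥ z) ⬝ᵥ (B e *ᵥ z) ≤ v * (z ⬝ᵥ z)) :
    μ.real {ω | ¬ ∀ z : Fin n → ℝ,
      |∑ e, noise w (winFraction Y ω) e.1.1 e.1.2 * (z ⬝ᵥ (B e *ᵥ z))| ≤
        13 * √(v * (Real.log n / L)) * (z ⬝ᵥ z)} ≤ ((n : ℝ) ^ 3)⁻¹ := by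
  have hLR : (0 : ℝ) < L := by exact_mod_cast hL
  have hnR : (2 : ℝ) ≤ n := by exact_mod_cast hn
  have hlog : 0 < Real.log n := Real.log_pos (by linarith)
  have hq : ⌈Real.log n⌉₊ ≠ 0 := (Nat.ceil_pos.2 hlog).ne'
  have ht : 0 < 13 * √(v * (Real.log n / L)) := by positivity
  set ρ : {e : Fin n × Fin n // e.1 < e.2 ∧ G.Adj e.1 e.2} × Fin L → ℝ :=
    fun k => w k.1.1.1 / (w k.1.1.1 + w k.1.1.2) with hρ
  set A : {e : Fin n × Fin n // e.1 < e.2 ∧ G.Adj e.1 e.2} × Fin L → Matrix (Fin n) (Fin n) ℝ :=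
    fun k => (1 / (L : ℝ)) • B k.1 with hA
  -- Each edge contributes `L` coins of weight `1 / L`, so averaging divides the variance by `L`.
  have hAv : ∀ z, ∑ k, (A k *ᵥ z) ⬝ᵥ (A k *ᵥ z) ≤ (v / L) * (z ⬝ᵥ z) := by
    intro z
    rw [Fintype.sum_prod_type]
    simp only [hA, smul_mulVec, dotProduct_smul, smul_dotProduct, smul_eq_mul, Finset.sum_const,
      Finset.card_univ, Fintype.card_fin, nsmul_eq_mul]
    rw [← Finset.mul_sum, ← Finset.mul_sum, ← Finset.mul_sum]
    have h1 : (L : ℝ) * (1 / L * (1 / L * ∑ e, (B e *ᵥ z) ⬝ᵥ (B e *ᵥ z))) =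
        (∑ e, (B e *ᵥ z) ⬝ᵥ (B e *ᵥ z)) / L := by
      field_simp
    rw [h1, div_mul_eq_mul_div]
    exact div_le_div_of_nonneg_right (hv z) hLR.le
  have hform : ∀ ω (z : Fin n → ℝ),
      z ⬝ᵥ (coinSeries ρ A (fun k => Y k.1.1.1 k.1.1.2 k.2 ω) *ᵥ z) =
        ∑ e, noise w (winFraction Y ω) e.1.1 e.1.2 * (z ⬝ᵥ (B e *ᵥ z)) := by
    intro ω z
    rw [coinSeries, sum_mulVec, dotProduct_sum, Fintype.sum_prod_type]
    refine Finset.sum_congr rfl fun e _ => ?_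
    simp only [hA, smul_mulVec, dotProduct_smul, smul_eq_mul]
    rw [← Finset.sum_mul, ← mul_assoc]
    congr 1
    simp only [centered, noise, winFraction, hρ]
    rw [Finset.sum_sub_distrib]
    simp only [Finset.sum_const, Finset.card_univ, Fintype.card_fin, nsmul_eq_mul]
    field_simp
  have hmain := measure_form_tail_le (μ := μ)
    (Y := fun (k : {e : Fin n × Fin n // e.1 < e.2 ∧ G.Adj e.1 e.2} × Fin L) =>
      Y k.1.1.1 k.1.1.2 k.2)
    (fun k => hY.measurable _ _ _ k.1.2.2) hY.indep (ρ := ρ)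
    (fun k => hY.law _ _ _ k.1.2.2) (A := A)
    (fun k => by simp only [hA, transpose_smul, hB]) (by positivity : 0 ≤ v / L) hAv hq ht
  simp only [hform, Fintype.card_fin] at hmain
  refine hmain.trans (tail_at_log_scale hn (by positivity) ?_)
  rw [mul_pow, Real.sq_sqrt (by positivity)]
  ring

/-- Concentration of weighted sums of the noise at each vertex. -/
theorem vertex_noise_tail_le [IsProbabilityMeasure μ] (hn : 2 ≤ n) (hL : 0 < L)
    (hd : ∀ i, 0 < G.degree i) (hw0 : ∀ i, 0 < w i)
    (hY : IsBTLSample G w L μ Y) {c : Fin n → Fin n → ℝ} {C : ℝ}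
    (hC : 0 < C) (hcC : ∀ i j, c i j ^ 2 ≤ C) :
    μ.real {ω | ¬ ∀ i, |∑ j ∈ G.neighborFinset i, noise w (winFraction Y ω) i j * c i j| ≤
        13 * √(C * (Real.log n / L)) * √(G.degree i : ℝ)} ≤ ((n : ℝ) ^ 3)⁻¹ := by
  have hdR : ∀ j, (0 : ℝ) < G.degree j := fun j => by exact_mod_cast hd j
  have hs : ∀ j, 0 < √(G.degree j : ℝ) := fun j => Real.sqrt_pos.2 (hdR j)
  set x : Fin n → Fin n → ℝ := fun i j => c i j / √(G.degree i : ℝ) with hx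
  -- All vertices are handled at once by one diagonal matrix series whose `i`-th entry is the
  -- normalized noise sum at `i`. The minus sign reflects the antisymmetry of the noise; testing
  -- with a unit vector recovers the sum at one vertex.
  set B : {e : Fin n × Fin n // e.1 < e.2 ∧ G.Adj e.1 e.2} → Matrix (Fin n) (Fin n) ℝ :=
    fun e => diagonal fun k => (if k = e.1.1 then x e.1.1 e.1.2 else 0) -
      (if k = e.1.2 then x e.1.2 e.1.1 else 0) with hBdef
  have hBform : ∀ e z, z ⬝ᵥ (B e *ᵥ z) =
      x e.1.1 e.1.2 * z e.1.1 ^ 2 - x e.1.2 e.1.1 * z e.1.2 ^ 2 := by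
    intro e z
    have h1 : ∀ k, z k * (((if k = e.1.1 then x e.1.1 e.1.2 else 0) -
        (if k = e.1.2 then x e.1.2 e.1.1 else 0)) * z k) =
        (if k = e.1.1 then x e.1.1 e.1.2 * z k ^ 2 else 0) -
          (if k = e.1.2 then x e.1.2 e.1.1 * z k ^ 2 else 0) := by
      intro k
      split_ifs <;> ring
    simp only [hBdef, dotProduct, mulVec_diagonal, h1, Finset.sum_sub_distrib]
    simp
  have hBsq : ∀ e z, (B e *ᵥ z) ⬝ᵥ (B e *ᵥ z) =
      (x e.1.1 e.1.2 * z e.1.1) ^ 2 + (x e.1.2 e.1.1 * z e.1.2) ^ 2 := by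
    intro e z
    have hne : e.1.1 ≠ e.1.2 := e.2.1.ne
    have h1 : ∀ k, ((if k = e.1.1 then x e.1.1 e.1.2 else 0) -
        (if k = e.1.2 then x e.1.2 e.1.1 else 0)) * z k *
        (((if k = e.1.1 then x e.1.1 e.1.2 else 0) -
        (if k = e.1.2 then x e.1.2 e.1.1 else 0)) * z k) =
        (if k = e.1.1 then (x e.1.1 e.1.2 * z k) ^ 2 else 0) +
          (if k = e.1.2 then (x e.1.2 e.1.1 * z k) ^ 2 else 0) := by
      intro k
      by_cases h1 : k = e.1.1
      · have h2 : k ≠ e.1.2 := h1 ▸ hne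
        simp only [if_pos h1, if_neg h2]
        ring
      · simp only [if_neg h1]
        split_ifs <;> ring
    simp only [hBdef, dotProduct, mulVec_diagonal, h1, Finset.sum_add_distrib]
    simp
  have hv : ∀ z, ∑ e, (B e *ᵥ z) ⬝ᵥ (B e *ᵥ z) ≤ C * (z ⬝ᵥ z) := by
    intro z
    simp only [hBsq]
    rw [sum_edges (fun i j => (x i j * z i) ^ 2), dotProduct, Finset.mul_sum]
    refine Finset.sum_le_sum fun i _ => ?_
    have h1 : ∀ j ∈ G.neighborFinset i, (x i j * z i) ^ 2 ≤ C * (z i * z i) / G.degree i := by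
      intro j _
      rw [hx, mul_pow, div_pow, Real.sq_sqrt (hdR i).le, ← sq, div_mul_eq_mul_div]
      exact div_le_div_of_nonneg_right
        (mul_le_mul_of_nonneg_right (hcC i j) (sq_nonneg _)) (hdR i).le
    refine (Finset.sum_le_card_nsmul _ _ _ h1).trans_eq ?_
    rw [SimpleGraph.card_neighborFinset_eq_degree, nsmul_eq_mul, mul_div_cancel₀ _ (hdR i).ne']
  refine le_trans (measureReal_mono ?_ (measure_ne_top _ _))
    (edge_form_tail_le hn hL hY (B := B) (fun e => diagonal_transpose _) hC hv)
  intro ω hω hall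
  refine hω fun i => ?_
  have h1 := hall (Pi.single i 1)
  have h2 : ∑ e : {e : Fin n × Fin n // e.1 < e.2 ∧ G.Adj e.1 e.2},
      noise w (winFraction Y ω) e.1.1 e.1.2 *
        ((Pi.single i 1 : Fin n → ℝ) ⬝ᵥ (B e *ᵥ (Pi.single i 1 : Fin n → ℝ))) =
      (∑ j ∈ G.neighborFinset i, noise w (winFraction Y ω) i j * c i j) /
        √(G.degree i : ℝ) := by
    have h3 : ∀ e : {e : Fin n × Fin n // e.1 < e.2 ∧ G.Adj e.1 e.2},
        noise w (winFraction Y ω) e.1.1 e.1.2 *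
          ((Pi.single i 1 : Fin n → ℝ) ⬝ᵥ (B e *ᵥ (Pi.single i 1 : Fin n → ℝ))) =
        (fun a a' => noise w (winFraction Y ω) a a' * x a a' *
            (Pi.single i 1 : Fin n → ℝ) a ^ 2) e.1.1 e.1.2 +
          (fun a a' => noise w (winFraction Y ω) a a' * x a a' *
            (Pi.single i 1 : Fin n → ℝ) a ^ 2) e.1.2 e.1.1 := by
      intro e
      rw [hBform]
      simp only
      rw [noise_swap hw0 (winFraction_swap hL hY ω _ _ e.2.2)]
      ring
    rw [Finset.sum_congr rfl fun e _ => h3 e,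
      sum_edges fun a a' => noise w (winFraction Y ω) a a' * x a a' *
        (Pi.single i 1 : Fin n → ℝ) a ^ 2, Finset.sum_eq_single i, Finset.sum_div]
    · refine Finset.sum_congr rfl fun j _ => ?_
      simp [hx, mul_div_assoc]
    · intro k _ hk
      simp [hk]
    · simp
  rw [h2, abs_div, abs_of_pos (hs i), div_le_iff₀ (hs i)] at h1
  simpa using h1

/-- Concentration of the bilinear form of the noise. -/
theorem noise_form_tail_le [IsProbabilityMeasure μ] (hn : 2 ≤ n) (hL : 0 < L)
    (hdmax : 0 < G.maxDegree) (hw0 : ∀ i, 0 < w i) (hw1 : ∀ i, w i ≤ 1)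
    (hY : IsBTLSample G w L μ Y) :
    μ.real {ω | ¬ ∀ h : Fin n → ℝ,
      |∑ i, ∑ j ∈ G.neighborFinset i, noise w (winFraction Y ω) i j * w j * (h i * h j)| ≤
        13 * √(G.maxDegree * (Real.log n / L)) * ∑ i, h i ^ 2} ≤ ((n : ℝ) ^ 3)⁻¹ := by
  -- Since the noise is antisymmetric, the two orientations of an edge combine to the coefficient `w
  -- j - w i`, spread over a symmetric matrix.
  set B : {e : Fin n × Fin n // e.1 < e.2 ∧ G.Adj e.1 e.2} → Matrix (Fin n) (Fin n) ℝ :=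
    fun e => ((w e.1.2 - w e.1.1) / 2) •
      (Matrix.single e.1.1 e.1.2 1 + Matrix.single e.1.2 e.1.1 1) with hBdef
  have hBz : ∀ e z, B e *ᵥ z = ((w e.1.2 - w e.1.1) / 2) •
      ((Pi.single e.1.1 (z e.1.2) : Fin n → ℝ) + Pi.single e.1.2 (z e.1.1)) := by
    intro e z
    simp only [hBdef, smul_mulVec, add_mulVec, single_mulVec, one_mul]
    rfl
  have hBform : ∀ e z, z ⬝ᵥ (B e *ᵥ z) = (w e.1.2 - w e.1.1) * (z e.1.1 * z e.1.2) := by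
    intro e z
    rw [hBz, dotProduct_smul, dotProduct_add, dotProduct_single, dotProduct_single, smul_eq_mul]
    ring
  have hBsq : ∀ e z, (B e *ᵥ z) ⬝ᵥ (B e *ᵥ z) ≤ z e.1.1 ^ 2 + z e.1.2 ^ 2 := by
    intro e z
    have hne : e.1.1 ≠ e.1.2 := e.2.1.ne
    rw [hBz, dotProduct_smul, smul_dotProduct, add_dotProduct, single_dotProduct,
      single_dotProduct]
    simp only [Pi.add_apply, Pi.single_eq_same, Pi.single_eq_of_ne hne, Pi.single_eq_of_ne hne.symm,
      add_zero, zero_add, smul_eq_mul]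
    have h1 : ((w e.1.2 - w e.1.1) / 2) ^ 2 ≤ 1 := by
      rw [sq_le_one_iff_abs_le_one, abs_le]
      constructor <;> linarith [hw0 e.1.1, hw0 e.1.2, hw1 e.1.1, hw1 e.1.2]
    nlinarith [mul_le_mul_of_nonneg_right h1 (add_nonneg (sq_nonneg (z e.1.1))
      (sq_nonneg (z e.1.2)))]
  have hv : ∀ z, ∑ e, (B e *ᵥ z) ⬝ᵥ (B e *ᵥ z) ≤ (G.maxDegree : ℝ) * (z ⬝ᵥ z) := by
    intro z
    refine (Finset.sum_le_sum fun e _ => hBsq e z).trans ?_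
    rw [sum_edges (fun i _ => z i ^ 2), sum_neighborFinset_left, dotProduct, Finset.mul_sum]
    refine Finset.sum_le_sum fun i _ => ?_
    rw [← sq]
    exact mul_le_mul_of_nonneg_right (by exact_mod_cast G.degree_le_maxDegree i) (sq_nonneg _)
  refine le_trans (measureReal_mono ?_ (measure_ne_top _ _))
    (edge_form_tail_le hn hL hY (B := B) (fun e => ?_) (by exact_mod_cast hdmax) hv)
  · intro ω hω hall
    refine hω fun h => ?_
    have h1 := hall h
    have h2 : ∀ e : {e : Fin n × Fin n // e.1 < e.2 ∧ G.Adj e.1 e.2},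
        noise w (winFraction Y ω) e.1.1 e.1.2 * (h ⬝ᵥ (B e *ᵥ h)) =
        (fun a a' => noise w (winFraction Y ω) a a' * w a' * (h a * h a')) e.1.1 e.1.2 +
          (fun a a' => noise w (winFraction Y ω) a a' * w a' * (h a * h a')) e.1.2 e.1.1 := by
      intro e
      rw [hBform]
      simp only
      rw [noise_swap hw0 (winFraction_swap hL hY ω _ _ e.2.2)]
      ring
    rw [Finset.sum_congr rfl fun e _ => h2 e,
      sum_edges fun a a' => noise w (winFraction Y ω) a a' * w a' * (h a * h a')] at h1
    simpa only [dotProduct, ← sq] using h1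
  · simp only [hBdef, transpose_smul, transpose_add, transpose_single]
    rw [add_comm]

end Random

/-! ### Normalization, choice of constants and conclusion. -/

/-- The sampling model only depends on the ratios of the scores. -/
lemma IsBTLSample.div_const {n L : ℕ} {G : SimpleGraph (Fin n)} {w : Fin n → ℝ} {Ω : Type*}
    [MeasurableSpace Ω] {μ : Measure Ω} {Y : Fin n → Fin n → Fin L → Ω → Bool}
    (hY : IsBTLSample G w L μ Y) {M : ℝ} (hM : 0 < M) :
    IsBTLSample G (fun i => w i / M) L μ Y := by
  refine ⟨hY.measurable, fun i j l h => ?_, hY.swap, hY.indep⟩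
  rw [hY.law i j l h, ← add_div, div_div_div_cancel_right₀ hM.ne']

/-- The result for scores with maximum at most one. -/
theorem normalized_returns {n : ℕ} {G : SimpleGraph (Fin n)} [DecidableRel G.Adj] {b : ℝ}
    (hb : 1 ≤ b) {L : ℕ} {w : Fin n → ℝ} {Ω : Type*}
    [MeasurableSpace Ω] {μ : Measure Ω} [IsProbabilityMeasure μ]
    {Y : Fin n → Fin n → Fin L → Ω → Bool} (hn : 2 ≤ n) (hL : 0 < L) (hd : ∀ i, 0 < G.degree i)
    (hw0 : ∀ i, 0 < w i) (hw1 : ∀ i, w i ≤ 1) (hwb : ∀ i, 1 ≤ b * w i)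
    (hY : IsBTLSample G w L μ Y) (hγ : 0 < spectralGap (laplacian G)) {Δ : ℝ} (hΔ0 : 0 < Δ)
    (hΔ1 : Δ ≤ 1) {S : Finset (Fin n)} (hsep : ∀ i ∈ S, ∀ j ∉ S, Δ ≤ w i - w j)
    (h1 : (104 * b) ^ 2 * (Real.log n / (G.maxDegree : ℝ)) *
      ((G.maxDegree : ℝ) / (spectralGap (laplacian G) * (G.minDegree : ℝ))) ^ 2 ≤ L)
    (h2 : (5000 * b ^ 3 * (√n * (G.maxDegree : ℝ) /
        (spectralGap (laplacian G) * (G.minDegree : ℝ)) * norm2Inf (laplacian G ^ 2))) ^ 2 *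
        (Real.log n / (G.maxDegree * Δ ^ 2)) ≤ L) :
    1 - 2 * (n : ℝ) ^ (-2 : ℤ) ≤
      μ.real {ω | Returns G (winFraction Y ω) S.card S} := by
  set γ := spectralGap (laplacian G) with hγdef
  have hb0 : 0 < b := by linarith
  have hn0 : 0 < n := by omega
  have hnR : (2 : ℝ) ≤ n := by exact_mod_cast hn
  have hLR : (0 : ℝ) < L := by exact_mod_cast hL
  have hlog : 0 < Real.log n := Real.log_pos (by linarith)
  have hdR : ∀ j, (0 : ℝ) < G.degree j := fun j => by exact_mod_cast hd j
  have hmini : ∀ j, (G.minDegree : ℝ) ≤ G.degree j := fun j => by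
    exact_mod_cast G.minDegree_le_degree j
  have hmaxi : ∀ i, (G.degree i : ℝ) ≤ G.maxDegree := fun i => by
    exact_mod_cast G.degree_le_maxDegree i
  have hmin : (0 : ℝ) < G.minDegree := by
    have : Nonempty (Fin n) := ⟨⟨0, hn0⟩⟩
    obtain ⟨k, hk⟩ := G.exists_minimal_degree_vertex
    rw [hk]; exact hdR k
  have hmax : (0 : ℝ) < G.maxDegree := (hdR ⟨0, hn0⟩).trans_le (hmaxi _)
  have hdmax : 0 < G.maxDegree := by exact_mod_cast hmax
  set l := Real.log n / L with hl
  have hl0 : 0 < l := div_pos hlog hLR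
  set r := √(G.maxDegree : ℝ) with hr
  have hr0 : 0 < r := Real.sqrt_pos.2 hmax
  have hr2 : r ^ 2 = G.maxDegree := Real.sq_sqrt hmax.le
  have hlog_eq : Real.log n = l * L := by rw [hl]; field_simp
  -- The square root of the first sample-size condition; `104 = 8 * 13` matches the tail constant to
  -- the threshold `γ / (8 * b)`.
  have hq1 : 104 * b * (√l * r) ≤ γ * G.minDegree := by
    have h3 : (104 * b) ^ 2 * (l * G.maxDegree) ≤ (γ * G.minDegree) ^ 2 := by
      rw [hlog_eq] at h1
      have h4 : (104 * b) ^ 2 * (l * L / (G.maxDegree : ℝ)) *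
          ((G.maxDegree : ℝ) / (γ * (G.minDegree : ℝ))) ^ 2 =
          ((104 * b) ^ 2 * (l * G.maxDegree) / (γ * G.minDegree) ^ 2) * L := by
        field_simp
      rw [h4] at h1
      have h5 := le_of_mul_le_mul_right (h1.trans_eq (one_mul _).symm) hLR
      rwa [div_le_one (by positivity)] at h5
    refine le_of_sq_le_sq ?_ (by positivity)
    rw [mul_pow, mul_pow (√l), Real.sq_sqrt hl0.le, hr2]
    exact h3
  set R := √n * (G.maxDegree : ℝ) / (γ * (G.minDegree : ℝ)) * norm2Inf (laplacian G ^ 2) with hR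
  have hR0 : 0 ≤ R := mul_nonneg (by positivity) (norm2Inf_nonneg _)
  -- The square root of the second condition. The error bound needs `84 * 13 * 2 = 2184` to stay
  -- below half of `5000`.
  have hq2 : 5000 * b ^ 3 * R * √l ≤ r * Δ := by
    have h3 : (5000 * b ^ 3 * R) ^ 2 * l ≤ G.maxDegree * Δ ^ 2 := by
      rw [hlog_eq] at h2
      have h4 : (5000 * b ^ 3 * R) ^ 2 * (l * L / (G.maxDegree * Δ ^ 2)) =
          ((5000 * b ^ 3 * R) ^ 2 * l / (G.maxDegree * Δ ^ 2)) * L := by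
        ring
      rw [h4] at h2
      have h5 := le_of_mul_le_mul_right (h2.trans_eq (one_mul _).symm) hLR
      rwa [div_le_one (by positivity)] at h5
    refine le_of_sq_le_sq ?_ (by positivity)
    rw [mul_pow, mul_pow r, Real.sq_sqrt hl0.le, hr2]
    exact h3
  set bad₁ := {ω | ¬ ∀ i, |∑ j ∈ G.neighborFinset i, noise w (winFraction Y ω) i j * 1| ≤
        13 * √(1 * l) * √(G.degree i : ℝ)} with hbad₁
  set bad₂ := {ω | ¬ ∀ i, |∑ j ∈ G.neighborFinset i,
      noise w (winFraction Y ω) i j * (w i + w j)| ≤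
        13 * √(4 * l) * √(G.degree i : ℝ)} with hbad₂
  set bad₃ := {ω | ¬ ∀ h : Fin n → ℝ,
      |∑ i, ∑ j ∈ G.neighborFinset i, noise w (winFraction Y ω) i j * w j * (h i * h j)| ≤
        13 * √(G.maxDegree * l) * ∑ i, h i ^ 2} with hbad₃
  have hp₁ : μ.real bad₁ ≤ ((n : ℝ) ^ 3)⁻¹ :=
    vertex_noise_tail_le hn hL hd hw0 hY (c := fun _ _ => 1) one_pos (by simp)
  have hp₂ : μ.real bad₂ ≤ ((n : ℝ) ^ 3)⁻¹ :=
    vertex_noise_tail_le hn hL hd hw0 hY (c := fun i j => w i + w j) (by norm_num)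
      fun i j => by nlinarith [hw0 i, hw0 j, hw1 i, hw1 j]
  have hp₃ : μ.real bad₃ ≤ ((n : ℝ) ^ 3)⁻¹ := noise_form_tail_le hn hL hdmax hw0 hw1 hY
  -- Covering the whole space and using subadditivity avoids any measurability question about the
  -- success event.
  have hcover : Set.univ ⊆
      {ω | Returns G (winFraction Y ω) S.card S} ∪ (bad₁ ∪ (bad₂ ∪ bad₃)) := by
    intro ω _
    by_contra hω
    simp only [Set.mem_union, not_or] at hω
    obtain ⟨hgood, hb₁, hb₂, hb₃⟩ := hω
    simp only [hbad₁, hbad₂, hbad₃, Set.mem_ofPred_eq, not_not, mul_one, one_mul] at hb₁ hb₂ hb₃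
    refine hgood (returns_of_noise_bounds hn0 hd hb hw0 hw1 hwb (winFraction_nonneg ω)
      (winFraction_swap hL hY ω) hγ (fun i => (hb₁ i).trans ?_) (by positivity) hb₂
      (fun h => (hb₃ h).trans ?_) hΔ1 ?_ hsep)
    · have hs := Real.mul_self_sqrt (hdR i).le
      have hs0 : 0 < √(G.degree i : ℝ) := Real.sqrt_pos.2 (hdR i)
      have hsr : √(G.degree i : ℝ) ≤ r := Real.sqrt_le_sqrt (hmaxi i)
      have h3 : 13 * √l * r ≤ γ / (8 * b) * G.minDegree := by
        rw [div_mul_eq_mul_div, le_div_iff₀ (by positivity)]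
        linarith
      have h4 : 13 * √l * √(G.degree i : ℝ) * r ≤ γ / (8 * b) * G.degree i * r :=
        calc 13 * √l * √(G.degree i : ℝ) * r = 13 * √l * r * √(G.degree i : ℝ) := by ring
          _ ≤ γ / (8 * b) * G.minDegree * √(G.degree i : ℝ) :=
              mul_le_mul_of_nonneg_right h3 hs0.le
          _ ≤ γ / (8 * b) * G.degree i * r := by
              refine mul_le_mul (mul_le_mul_of_nonneg_left (hmini i) (by positivity)) hsr hs0.le
                (by positivity)
      exact le_of_mul_le_mul_right h4 hr0
    · have h3 : 13 * √(G.maxDegree * l) ≤ γ / (8 * b) * G.minDegree := by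
        rw [Real.sqrt_mul hmax.le, ← hr, div_mul_eq_mul_div, le_div_iff₀ (by positivity)]
        linarith
      refine (mul_le_mul_of_nonneg_right h3
        (Finset.sum_nonneg fun i _ => sq_nonneg (h i))).trans ?_
      rw [mul_assoc, Finset.mul_sum]
      refine mul_le_mul_of_nonneg_left (Finset.sum_le_sum fun i _ => ?_) (by positivity)
      exact mul_le_mul_of_nonneg_right (hmini i) (sq_nonneg _)
    · have h4 : √(4 * l) = 2 * √l := by
        rw [Real.sqrt_mul (by norm_num), show (4 : ℝ) = 2 ^ 2 by norm_num,
          Real.sqrt_sq (by norm_num)]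
      rw [h4, mul_div_assoc', div_lt_iff₀ hr0]
      have h5 : 0 < r * Δ := mul_pos hr0 hΔ0
      calc 84 * b ^ 3 * R * (13 * (2 * √l)) = 2184 / 5000 * (5000 * b ^ 3 * R * √l) := by ring
        _ ≤ 2184 / 5000 * (r * Δ) := mul_le_mul_of_nonneg_left hq2 (by norm_num)
        _ < Δ / 2 * r := by linarith
  have htotal : (1 : ℝ) ≤ μ.real {ω | Returns G (winFraction Y ω) S.card S} +
      3 * ((n : ℝ) ^ 3)⁻¹ := by
    have h3 := measureReal_mono (μ := μ) hcover (measure_ne_top _ _)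
    rw [probReal_univ] at h3
    have h4 := measureReal_union_le (μ := μ) {ω | Returns G (winFraction Y ω) S.card S}
      (bad₁ ∪ (bad₂ ∪ bad₃))
    have h5 := measureReal_union_le (μ := μ) bad₁ (bad₂ ∪ bad₃)
    have h6 := measureReal_union_le (μ := μ) bad₂ bad₃
    linarith
  -- Three bad events of probability at most `n⁻³` fit, because `3 ≤ 2 * n` for `n ≥ 2`.
  have hfin : 3 * ((n : ℝ) ^ 3)⁻¹ ≤ 2 * (n : ℝ) ^ (-2 : ℤ) := by
    have h3 : (n : ℝ) ^ (-2 : ℤ) = n * ((n : ℝ) ^ 3)⁻¹ := by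
      rw [_root_.zpow_neg]
      have : (n : ℝ) ≠ 0 := by linarith
      field_simp
    rw [h3]
    have h4 : 0 < ((n : ℝ) ^ 3)⁻¹ := by positivity
    nlinarith
  linarith

lemma card_firstItems {n K : ℕ} (hK : K < n) : (firstItems n K).card = K := by
  have h : firstItems n K = Finset.Iio (⟨K, hK⟩ : Fin n) := by
    ext i
    simp [firstItems, Fin.lt_def]
  rw [h, Fin.card_Iio]

end RankCentrality

theorem theorem1 (b : ℝ) (hb : 1 ≤ b) :
    ∃ c₁ c₂ c₃ : ℝ, 0 < c₁ ∧ 0 < c₂ ∧ 0 < c₃ ∧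
      ∀ (n : ℕ) (G : SimpleGraph (Fin n)) [DecidableRel G.Adj] (w : Fin n → ℝ) (K L : ℕ)
        (_hK₁ : 1 ≤ K) (hKn : K < n)
        {Ω : Type*} [MeasurableSpace Ω] (μ : Measure Ω) [IsProbabilityMeasure μ]
        (Y : Fin n → Fin n → Fin L → Ω → Bool),
        G.Connected →
        (∀ i, 0 < w i) → Antitone w → (∀ i j, w i ≤ b * w j) →
        RankCentrality.IsBTLSample G w L μ Y →
        0 < RankCentrality.spectralGap (RankCentrality.laplacian G) →
        0 < RankCentrality.separation w K hKn →
        ⌈c₁ * (Real.log n / (G.maxDegree : ℝ)) *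
            ((G.maxDegree : ℝ) /
              (RankCentrality.spectralGap (RankCentrality.laplacian G) * (G.minDegree : ℝ))) ^ 2⌉₊
          ≤ L →
        (c₂ + c₃ * (Real.sqrt n * (G.maxDegree : ℝ) /
              (RankCentrality.spectralGap (RankCentrality.laplacian G) * (G.minDegree : ℝ))) *
              RankCentrality.norm2Inf (RankCentrality.laplacian G ^ 2)) ^ 2 *
            ((G.edgeFinset.card : ℝ) * Real.log n /
              ((G.maxDegree : ℝ) * RankCentrality.separation w K hKn ^ 2))
          ≤ (L : ℝ) * (G.edgeFinset.card : ℝ) →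
        1 - 2 * (n : ℝ) ^ (-2 : ℤ) ≤
          μ.real {ω | RankCentrality.Returns G (RankCentrality.winFraction Y ω) K
            (RankCentrality.firstItems n K)} := by

  have hb0 : 0 < b := by linarith
  -- Any positive `c₂` would do: it is simply dropped, as the lower-order error is already absorbed
  -- into the `c₃` term.
  refine ⟨(104 * b) ^ 2, 1, 5000 * b ^ 3, by positivity, one_pos, by positivity, ?_⟩
  intro n G _ w K L hK₁ hKn Ω _ μ _ Y hG hw hanti hwb hY hγ hΔ h1 h2
  have hn : 2 ≤ n := by omega
  have : Nontrivial (Fin n) := Fin.nontrivial_iff_two_le.2 hn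
  have hnR : (2 : ℝ) ≤ n := by exact_mod_cast hn
  have hlog : 0 < Real.log n := Real.log_pos (by linarith)
  have hd : ∀ i, 0 < G.degree i := fun i => hG.preconnected.degree_pos_of_nontrivial i
  have hmin : (0 : ℝ) < G.minDegree := by
    obtain ⟨k, hk⟩ := G.exists_minimal_degree_vertex
    rw [hk]; exact_mod_cast hd k
  have hmax : (0 : ℝ) < G.maxDegree := by
    exact_mod_cast (hd ⟨0, by omega⟩).trans_le (G.degree_le_maxDegree _)
  have h1' := Nat.ceil_le.1 h1
  have hL : 0 < L := by
    have h3 : (0 : ℝ) < L := lt_of_lt_of_le (by positivity) h1'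
    exact_mod_cast h3
  have hbdd : BddAbove (Set.range w) := (Set.finite_range w).bddAbove
  set M := ⨆ i, w i with hM
  have hwM : ∀ i, w i ≤ M := fun i => le_ciSup hbdd i
  have hM0 : 0 < M := (hw ⟨0, by omega⟩).trans_le (hwM _)
  have hMb : ∀ i, M ≤ b * w i := fun i => ciSup_le fun j => hwb j i
  set Δ := RankCentrality.separation w K hKn with hΔdef
  have hΔeq : Δ = w ⟨K - 1, lt_of_le_of_lt (Nat.sub_le K 1) hKn⟩ / M - w ⟨K, hKn⟩ / M := by
    rw [hΔdef, RankCentrality.separation, ← hM, sub_div]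
  have hΔ1 : Δ ≤ 1 := by
    have h3 := div_le_one_of_le₀ (hwM ⟨K - 1, lt_of_le_of_lt (Nat.sub_le K 1) hKn⟩) hM0.le
    have h4 := div_pos (hw ⟨K, hKn⟩) hM0
    linarith
  have hE : (0 : ℝ) < G.edgeFinset.card := by
    have h3 := G.sum_degrees_eq_twice_card_edges
    have h4 : 0 < ∑ v, G.degree v := Finset.sum_pos (fun i _ => hd i) Finset.univ_nonempty
    have h5 : 0 < G.edgeFinset.card := by omega
    exact_mod_cast h5
  have hsep : ∀ i ∈ RankCentrality.firstItems n K, ∀ j ∉ RankCentrality.firstItems n K,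
      Δ ≤ w i / M - w j / M := by
    intro i hi j hj
    simp only [RankCentrality.firstItems, Finset.mem_filter, Finset.mem_univ, true_and,
      not_lt] at hi hj
    have h3 := div_le_div_of_nonneg_right
      (hanti (show i ≤ ⟨K - 1, lt_of_le_of_lt (Nat.sub_le K 1) hKn⟩ from
        Fin.le_def.2 (show i.val ≤ K - 1 by omega))) hM0.le
    have h4 := div_le_div_of_nonneg_right
      (hanti (show (⟨K, hKn⟩ : Fin n) ≤ j from Fin.le_def.2 hj)) hM0.le
    linarith
  have hmain := RankCentrality.normalized_returns hb hn hL hd (fun i => div_pos (hw i) hM0)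
    (fun i => div_le_one_of_le₀ (hwM i) hM0.le)
    (fun i => by rw [mul_div_assoc', one_le_div hM0]; exact hMb i)
    (hY.div_const hM0) hγ hΔ hΔ1 hsep h1' (by
      set R := √n * (G.maxDegree : ℝ) /
        (RankCentrality.spectralGap (RankCentrality.laplacian G) * (G.minDegree : ℝ)) with hR
      set N := RankCentrality.norm2Inf (RankCentrality.laplacian G ^ 2) with hN
      have hN0 : 0 ≤ N := RankCentrality.norm2Inf_nonneg _
      have hR0 : 0 ≤ R := by positivity
      -- The number of edges, positive here, cancels from both sides of the sample-size condition.
      have h3 : (1 + 5000 * b ^ 3 * R * N) ^ 2 *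
          (Real.log n / (G.maxDegree * Δ ^ 2)) ≤ L := by
        refine le_of_mul_le_mul_right (le_of_eq_of_le ?_ h2) hE
        ring
      refine le_trans (mul_le_mul_of_nonneg_right ?_ (by positivity)) h3
      refine pow_le_pow_left₀ (by positivity) ?_ 2
      rw [← mul_assoc]
      linarith)
  rwa [RankCentrality.card_firstItems hKn] at hmain
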